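/- Let $\Lambda, L$ be Banach lattices, both real or both complex (a complex Banach lattice is the complexification $E+iE$ of a real Banach lattice $E$ with modulus $|a+ib|=(|a|^2+|b|^2)^{1/2}$ and norm $\|a+ib\|=\|\,|a+ib|\,\|_E$), and let $S\subset\Lambda$ be a closed subspace. A bounded linear operator $u$ from a Banach lattice $X$, or from a closed subspace $X$ of a Banach lattice, to a Banach lattice $Y$ is called regular if there is a constant $C\ge 0$ such that $$\Big\|\sup_{i\le m}|u(x_i)|\Big\|\le C\,\Big\|\sup_{i\le m}|x_i|\Big\|$$ for all finite sequences $x_1,\dots,x_m$ in $X$; the least such $C$ is the regular norm $\|u\|_r$. Assume that $L$ is a dual lattice (i.e. isometrically and order isomorphic to the dual of a Banach lattice) or, more generally, that there is a regular projection $P\colon L^{**}\to L$ (that is, $P$ restricts to the identity on $L$, canonically embedded in $L^{**}$) with $\|P\|_r\le 1$. Assume moreover that for some $1\le p\le\infty$ the lattice $\Lambda$ is $p$-convex with constant $1$ and $L$ is $p$-concave with constant $1$, i.e. $$\Big\|\Big(\sum_i|x_i|^p\Big)^{1/p}\Big\|\le\Big(\sum_i\|x_i\|^p\Big)^{1/p}\quad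 (x_i\in\Lambda),\qquad \Big(\sum_i\|y_i\|^p\Big)^{1/p}\le\Big\|\Big(\sum_i|y_i|^p\Big)^{1/p}\Big\|\quad (y_i\in L)$$ for all finite sequences (with suprema in place of $p$-sums when $p=\infty$). Then every regular operator $u\colon S\to L$ extends to a regular operator $\tilde u\colon\Lambda\to L$ with $\|\tilde u\|_r=\|u\|_r$. -/

import Mathlib

open scoped ENNReal

universe u v w

namespace BanachLat

/-! ### `p`-sums in a Banach lattice -/

section Sums

set_option linter.unusedSectionVars false

theorem norm_le_of_nonneg_of_le {E : Type u} [NormedAddCommGroup E] [Lattice E]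
    [IsOrderedAddMonoid E] [HasSolidNorm E] {x y : E} (h0 : 0 ≤ x) (h : x ≤ y) : ‖x‖ ≤ ‖y‖ :=
  norm_le_norm_of_abs_le_abs (by rwa [abs_of_nonneg h0, abs_of_nonneg (h0.trans h)])

variable {E : Type u} [NormedAddCommGroup E] [NormedSpace ℝ E] [Lattice E] [IsOrderedAddMonoid E]
  [HasSolidNorm E] [IsOrderedModule ℝ E] [CompleteSpace E]

theorem smul_le_abs_smul_abs (c : ℝ) (x : E) : c • x ≤ |c| • |x| := by
  rcases le_total 0 c with hc | hc
  · rw [abs_of_nonneg hc]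
    exact smul_le_smul_of_nonneg_left (le_abs_self x) hc
  · rw [abs_of_nonpos hc, ← neg_smul_neg]
    exact smul_le_smul_of_nonneg_left (neg_le_abs x) (by linarith)

/-- In a Banach lattice, a family of linear combinations of finitely many vectors, whose
coefficients run through a bounded set, has a least upper bound. -/
theorem exists_isLUB_linearComb {n : ℕ} (A : Set (Fin n → ℝ)) (hne : A.Nonempty)
    (hb : Bornology.IsBounded A) (x : Fin n → E) :
    ∃ m, IsLUB ((fun a : Fin n → ℝ => ∑ i, a i • x i) '' A) m := by
  set φ : (Fin n → ℝ) → E := fun a => ∑ i, a i • x i with hφ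
  set W : E := ∑ i, |x i| with hW
  have hW0 : 0 ≤ W := Finset.sum_nonneg fun i _ => abs_nonneg _
  have hclose : ∀ a b : Fin n → ℝ, ∀ ε : ℝ, dist a b < ε → φ a ≤ φ b + ε • W := by
    intro a b ε h
    have : φ a - φ b ≤ ε • W := by
      rw [hφ, hW]
      simp only
      rw [← Finset.sum_sub_distrib, Finset.smul_sum]
      refine Finset.sum_le_sum fun i _ => ?_
      rw [← sub_smul]
      refine (smul_le_abs_smul_abs _ _).trans ?_
      refine smul_le_smul_of_nonneg_right ?_ (abs_nonneg _)
      rw [← Real.dist_eq]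
      exact (dist_le_pi_dist a b i).trans h.le
    rwa [sub_le_iff_le_add'] at this
  have hnet : ∀ k : ℕ, ∃ t : Finset (Fin n → ℝ), t.Nonempty ∧ (∀ a ∈ t, a ∈ A) ∧
      ∀ a ∈ A, ∃ b ∈ t, dist a b < 1 / ((k : ℝ) + 1) := by
    intro k
    have hk : (0 : ℝ) < 1 / ((k : ℝ) + 1) := by positivity
    have htb : TotallyBounded A :=
      (hb.isCompact_closure.totallyBounded).subset subset_closure
    obtain ⟨t, htA, htf, htc⟩ := Metric.finite_approx_of_totallyBounded htb _ hk
    have hcov : ∀ a ∈ A, ∃ b ∈ htf.toFinset, dist a b < 1 / ((k : ℝ) + 1) := by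
      intro a ha
      have := htc ha
      simp only [Set.mem_iUnion, Metric.mem_ball] at this
      obtain ⟨b, hbt, hd⟩ := this
      exact ⟨b, by simpa using hbt, hd⟩
    obtain ⟨a, ha⟩ := hne
    obtain ⟨b, hbt, -⟩ := hcov a ha
    exact ⟨htf.toFinset, ⟨b, hbt⟩, fun a ha => htA (by simpa using ha), hcov⟩
  choose t htne htA htc using hnet
  set s : ℕ → E := fun k => (t k).sup' (htne k) φ with hs
  have hup : ∀ a ∈ A, ∀ k, φ a ≤ s k + (1 / ((k : ℝ) + 1)) • W := by
    intro a ha k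
    obtain ⟨b, hbt, hd⟩ := htc k a ha
    refine (hclose a b _ hd).trans ?_
    gcongr
    exact Finset.le_sup' φ hbt
  have hle : ∀ k l, s k ≤ s l + (1 / ((l : ℝ) + 1)) • W := fun k l =>
    Finset.sup'_le _ _ fun a ha => hup a (htA k a ha) l
  have hlim : Filter.Tendsto (fun k : ℕ => 1 / ((k : ℝ) + 1)) Filter.atTop (nhds 0) :=
    tendsto_one_div_add_atTop_nhds_zero_nat
  have hcau : CauchySeq s := by
    refine cauchySeq_of_le_tendsto_0 (fun N : ℕ => ‖(1 / ((N : ℝ) + 1)) • W‖) ?_ ?_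
    · intro k l N hk hl
      rw [dist_eq_norm]
      have hmono : ∀ j, N ≤ j → (1 / ((j : ℝ) + 1)) • W ≤ (1 / ((N : ℝ) + 1)) • W := by
        intro j hj
        refine smul_le_smul_of_nonneg_right ?_ hW0
        have : (N : ℝ) ≤ j := by exact_mod_cast hj
        gcongr
      refine norm_le_norm_of_abs_le_abs ?_
      rw [abs_of_nonneg (smul_nonneg (by positivity) hW0)]
      refine abs_le'.2 ⟨?_, ?_⟩
      · rw [sub_le_iff_le_add']
        exact (hle k l).trans (by gcongr)
      · rw [neg_sub, sub_le_iff_le_add']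
        exact (hle l k).trans (by gcongr)
    · have := (hlim.smul_const W).norm
      simpa using this
  obtain ⟨m, hm⟩ := cauchySeq_tendsto_of_complete hcau
  refine ⟨m, ?_, ?_⟩
  · rintro _ ⟨a, ha, rfl⟩
    have h2 : Filter.Tendsto (fun k : ℕ => s k + (1 / ((k : ℝ) + 1)) • W) Filter.atTop
        (nhds (m + (0 : ℝ) • W)) := hm.add (hlim.smul_const W)
    rw [zero_smul, add_zero] at h2
    exact ge_of_tendsto' h2 fun k => hup a ha k
  · intro b hbb
    refine le_of_tendsto' hm fun k => Finset.sup'_le _ _ fun a ha => ?_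
    exact hbb ⟨a, htA k a ha, rfl⟩

/-- The coefficients `a` in the unit ball of `ℓ_q^n`, where `q` is conjugate to `p`. -/
def conjBall (p : ℝ≥0∞) (n : ℕ) : Set (Fin n → ℝ) :=
  {a | ‖WithLp.toLp p.conjExponent a‖ ≤ 1}

theorem one_le_conjExponent (p : ℝ≥0∞) : 1 ≤ p.conjExponent := by
  unfold ENNReal.conjExponent
  exact le_self_add

theorem abs_le_of_mem_conjBall {p : ℝ≥0∞} {n : ℕ} {a : Fin n → ℝ} (ha : a ∈ conjBall p n)
    (i : Fin n) : |a i| ≤ 1 := by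
  have : Fact (1 ≤ p.conjExponent) := ⟨one_le_conjExponent p⟩
  have := PiLp.norm_apply_le (WithLp.toLp p.conjExponent a) i
  exact this.trans ha

theorem exists_isLUB_lpSum (p : ℝ≥0∞) {n : ℕ} (x : Fin n → E) :
    ∃ m, IsLUB ((fun a : Fin n → ℝ => ∑ i, a i • x i) '' conjBall p n) m := by
  have : Fact (1 ≤ p.conjExponent) := ⟨one_le_conjExponent p⟩
  refine exists_isLUB_linearComb _ ⟨0, ?_⟩ ?_ x
  · simp [conjBall]
  · refine (Metric.isBounded_closedBall (x := (0 : Fin n → ℝ)) (r := 1)).subset fun a ha => ?_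
    rw [mem_closedBall_zero_iff, pi_norm_le_iff_of_nonneg zero_le_one]
    exact fun i => abs_le_of_mem_conjBall ha i

/-- The element `(∑ |x i| ^ p) ^ (1/p)` of a Banach lattice (for `p = ∞`: `sup |x i|`), i.e. the
least upper bound of all `∑ a i • x i` with `‖a‖_q ≤ 1`, where `1/p + 1/q = 1`. -/
noncomputable def lpSum (p : ℝ≥0∞) {n : ℕ} (x : Fin n → E) : E :=
  Classical.choose (exists_isLUB_lpSum p x)

theorem isLUB_lpSum (p : ℝ≥0∞) {n : ℕ} (x : Fin n → E) :
    IsLUB ((fun a : Fin n → ℝ => ∑ i, a i • x i) '' conjBall p n) (lpSum p x) :=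
  Classical.choose_spec (exists_isLUB_lpSum p x)

end Sums

/-! ### The dual of a Banach lattice -/

/-- The dual of a Banach lattice, as a Banach lattice: the space of bounded linear functionals
with the operator norm, ordered by the dual cone. -/
def DualLattice (E : Type u) [NormedAddCommGroup E] [NormedSpace ℝ E] : Type u :=
  StrongDual ℝ E

namespace DualLattice

section Basic

variable {E : Type u} [NormedAddCommGroup E] [NormedSpace ℝ E]

noncomputable instance : NormedAddCommGroup (DualLattice E) :=
  inferInstanceAs (NormedAddCommGroup (StrongDual ℝ E))

noncomputable instance : NormedSpace ℝ (DualLattice E) :=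
  inferInstanceAs (NormedSpace ℝ (StrongDual ℝ E))

instance : CompleteSpace (DualLattice E) :=
  inferInstanceAs (CompleteSpace (StrongDual ℝ E))

instance : FunLike (DualLattice E) E ℝ :=
  inferInstanceAs (FunLike (StrongDual ℝ E) E ℝ)

instance : ContinuousLinearMapClass (DualLattice E) ℝ E ℝ :=
  inferInstanceAs (ContinuousLinearMapClass (StrongDual ℝ E) ℝ E ℝ)

theorem ext' {f g : DualLattice E} (h : ∀ x, f x = g x) : f = g :=
  ContinuousLinearMap.ext h

theorem add_apply (f g : DualLattice E) (x : E) : (f + g) x = f x + g x := rfl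

theorem neg_apply (f : DualLattice E) (x : E) : (-f) x = -f x := rfl

theorem sub_apply (f g : DualLattice E) (x : E) : (f - g) x = f x - g x := rfl

theorem zero_apply (x : E) : (0 : DualLattice E) x = 0 := rfl

theorem smul_apply (c : ℝ) (f : DualLattice E) (x : E) : (c • f) x = c * f x := rfl

theorem abs_apply_le (f : DualLattice E) (x : E) : |f x| ≤ ‖f‖ * ‖x‖ :=
  ContinuousLinearMap.le_opNorm (f : StrongDual ℝ E) x

end Basic

section Order

set_option linter.unusedSectionVars false

variable {E : Type u} [NormedAddCommGroup E] [NormedSpace ℝ E] [Lattice E] [IsOrderedAddMonoid E]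
  [HasSolidNorm E] [IsOrderedModule ℝ E]

instance : PartialOrder (DualLattice E) where
  le f g := ∀ x : E, 0 ≤ x → f x ≤ g x
  le_refl f x _ := le_rfl
  le_trans f g h hfg hgh x hx := (hfg x hx).trans (hgh x hx)
  le_antisymm f g hfg hgf := by
    refine ext' fun x => ?_
    rw [← posPart_sub_negPart x, map_sub, map_sub,
      le_antisymm (hfg _ (posPart_nonneg x)) (hgf _ (posPart_nonneg x)),
      le_antisymm (hfg _ (negPart_nonneg x)) (hgf _ (negPart_nonneg x))]

theorem le_def {f g : DualLattice E} : f ≤ g ↔ ∀ x : E, 0 ≤ x → f x ≤ g x := Iff.rfl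

instance : IsOrderedAddMonoid (DualLattice E) where
  add_le_add_left f g h k x hx := by
    have := h x hx
    simp only [add_apply]
    linarith

/-- `sup {f y | 0 ≤ y ≤ x}`, the value at `x ≥ 0` of the positive part of `f`. -/
noncomputable def posVal (f : DualLattice E) (x : E) : ℝ := sSup (f '' Set.Icc 0 x)

theorem apply_le_of_mem (f : DualLattice E) {x y : E} (hy : y ∈ Set.Icc 0 x) :
    f y ≤ ‖f‖ * ‖x‖ :=
  ((le_abs_self _).trans (abs_apply_le f y)).trans
    (mul_le_mul_of_nonneg_left (norm_le_of_nonneg_of_le hy.1 hy.2) (norm_nonneg f))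

theorem bddAbove_posVal (f : DualLattice E) (x : E) : BddAbove (f '' Set.Icc 0 x) :=
  ⟨‖f‖ * ‖x‖, by rintro _ ⟨y, hy, rfl⟩; exact apply_le_of_mem f hy⟩

theorem le_posVal (f : DualLattice E) {x y : E} (h0 : 0 ≤ y) (h : y ≤ x) : f y ≤ posVal f x :=
  le_csSup (bddAbove_posVal f x) ⟨y, ⟨h0, h⟩, rfl⟩

theorem posVal_le (f : DualLattice E) {x : E} (hx : 0 ≤ x) {c : ℝ}
    (h : ∀ y, 0 ≤ y → y ≤ x → f y ≤ c) : posVal f x ≤ c :=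
  csSup_le ⟨f 0, 0, ⟨le_rfl, hx⟩, rfl⟩ (by rintro _ ⟨y, hy, rfl⟩; exact h y hy.1 hy.2)

theorem posVal_nonneg (f : DualLattice E) {x : E} (hx : 0 ≤ x) : 0 ≤ posVal f x := by
  simpa using le_posVal f le_rfl hx

theorem posVal_le_norm (f : DualLattice E) {x : E} (hx : 0 ≤ x) : posVal f x ≤ ‖f‖ * ‖x‖ :=
  posVal_le f hx fun _ h0 h => apply_le_of_mem f ⟨h0, h⟩

theorem posVal_add (f : DualLattice E) {x y : E} (hx : 0 ≤ x) (hy : 0 ≤ y) :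
    posVal f (x + y) = posVal f x + posVal f y := by
  refine le_antisymm (posVal_le f (add_nonneg hx hy) fun z h0 h => ?_) ?_
  · have h1 : f (z ⊓ x) ≤ posVal f x := le_posVal f (le_inf h0 hx) inf_le_right
    have h2 : f (z - z ⊓ x) ≤ posVal f y := by
      refine le_posVal f (sub_nonneg.2 inf_le_left) ?_
      rw [sub_le_iff_le_add, add_inf]
      exact le_inf (le_add_of_nonneg_left hy) (by rwa [add_comm])
    have : f z = f (z ⊓ x) + f (z - z ⊓ x) := by rw [← map_add]; congr 1; abel
    linarith
  · have key : ∀ a, 0 ≤ a → a ≤ x → f a ≤ posVal f (x + y) - posVal f y := by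
      intro a ha hax
      have : posVal f y ≤ posVal f (x + y) - f a := by
        refine posVal_le f hy fun b hb hby => ?_
        have := le_posVal f (add_nonneg ha hb) (add_le_add hax hby)
        rw [map_add] at this
        linarith
      linarith
    have := posVal_le f hx key
    linarith

theorem posVal_smul_le (f : DualLattice E) {c : ℝ} (hc : 0 < c) {x : E} (hx : 0 ≤ x) :
    posVal f (c • x) ≤ c * posVal f x := by
  refine posVal_le f (smul_nonneg hc.le hx) fun y h0 h => ?_
  have h1 : f (c⁻¹ • y) ≤ posVal f x := by
    refine le_posVal f (smul_nonneg (inv_nonneg.2 hc.le) h0) ?_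
    have := smul_le_smul_of_nonneg_left h (inv_nonneg.2 hc.le)
    rwa [inv_smul_smul₀ hc.ne'] at this
  rw [map_smul, smul_eq_mul] at h1
  have h2 := mul_le_mul_of_nonneg_left h1 hc.le
  rwa [mul_inv_cancel_left₀ hc.ne'] at h2

theorem posVal_smul (f : DualLattice E) {c : ℝ} (hc : 0 ≤ c) {x : E} (hx : 0 ≤ x) :
    posVal f (c • x) = c * posVal f x := by
  rcases hc.eq_or_lt with rfl | hc
  · rw [zero_smul, zero_mul]
    refine le_antisymm ?_ (posVal_nonneg f le_rfl)
    simpa using posVal_le_norm f (le_refl (0 : E))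
  · refine le_antisymm (posVal_smul_le f hc hx) ?_
    have := posVal_smul_le f (inv_pos.2 hc) (smul_nonneg hc.le hx)
    rw [inv_smul_smul₀ hc.ne'] at this
    have h2 := mul_le_mul_of_nonneg_left this hc.le
    rwa [mul_inv_cancel_left₀ hc.ne'] at h2

/-- The extension of `posVal f` from the positive cone by differences. -/
noncomputable def posFun (f : DualLattice E) (x : E) : ℝ := posVal f x⁺ - posVal f x⁻

theorem posFun_sub (f : DualLattice E) {a b : E} (ha : 0 ≤ a) (hb : 0 ≤ b) :
    posFun f (a - b) = posVal f a - posVal f b := by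
  have h : (a - b)⁺ + b = (a - b)⁻ + a := by
    have := posPart_sub_negPart (a - b)
    rw [sub_eq_sub_iff_add_eq_add] at this
    rw [this, add_comm]
  have h2 := posVal_add f (posPart_nonneg (a - b)) hb
  rw [h, posVal_add f (negPart_nonneg (a - b)) ha] at h2
  unfold posFun
  linarith

theorem posFun_of_nonneg (f : DualLattice E) {a : E} (ha : 0 ≤ a) :
    posFun f a = posVal f a := by
  simp [posFun, posPart_of_nonneg ha, negPart_of_nonneg ha,
    show posVal f (0 : E) = 0 by simpa using posVal_smul f le_rfl (le_refl (0 : E))]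

theorem posFun_add (f : DualLattice E) (x y : E) :
    posFun f (x + y) = posFun f x + posFun f y := by
  have : x + y = (x⁺ + y⁺) - (x⁻ + y⁻) := by
    conv_lhs => rw [← posPart_sub_negPart x, ← posPart_sub_negPart y]
    abel
  rw [this, posFun_sub f (add_nonneg (posPart_nonneg x) (posPart_nonneg y))
    (add_nonneg (negPart_nonneg x) (negPart_nonneg y)),
    posVal_add f (posPart_nonneg x) (posPart_nonneg y),
    posVal_add f (negPart_nonneg x) (negPart_nonneg y)]
  unfold posFun
  ring

theorem posFun_smul (f : DualLattice E) (c : ℝ) (x : E) :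
    posFun f (c • x) = c * posFun f x := by
  rcases le_total 0 c with hc | hc
  · have : c • x = c • x⁺ - c • x⁻ := by rw [← smul_sub, posPart_sub_negPart]
    rw [this, posFun_sub f (smul_nonneg hc (posPart_nonneg x)) (smul_nonneg hc (negPart_nonneg x)),
      posVal_smul f hc (posPart_nonneg x), posVal_smul f hc (negPart_nonneg x)]
    unfold posFun
    ring
  · have hc' : 0 ≤ -c := by linarith
    have : c • x = (-c) • x⁻ - (-c) • x⁺ := by
      rw [← smul_sub, ← neg_sub, posPart_sub_negPart, neg_smul_neg]
    rw [this, posFun_sub f (smul_nonneg hc' (negPart_nonneg x))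
      (smul_nonneg hc' (posPart_nonneg x)),
      posVal_smul f hc' (posPart_nonneg x), posVal_smul f hc' (negPart_nonneg x)]
    unfold posFun
    ring

theorem abs_posFun_le (f : DualLattice E) (x : E) : |posFun f x| ≤ ‖f‖ * ‖x‖ := by
  have h1 := posVal_nonneg f (posPart_nonneg x)
  have h2 := posVal_nonneg f (negPart_nonneg x)
  have n1 : ‖x⁺‖ ≤ ‖x‖ := by
    rw [← norm_abs_eq_norm x]
    exact norm_le_of_nonneg_of_le (posPart_nonneg x) (sup_le (le_abs_self x) (abs_nonneg x))
  have n2 : ‖x⁻‖ ≤ ‖x‖ := by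
    rw [← norm_abs_eq_norm x]
    exact norm_le_of_nonneg_of_le (negPart_nonneg x) (sup_le (neg_le_abs x) (abs_nonneg x))
  have h3 := (posVal_le_norm f (posPart_nonneg x)).trans
    (mul_le_mul_of_nonneg_left n1 (norm_nonneg f))
  have h4 := (posVal_le_norm f (negPart_nonneg x)).trans
    (mul_le_mul_of_nonneg_left n2 (norm_nonneg f))
  unfold posFun
  rw [abs_le]
  constructor <;> linarith

/-- The positive part `f ⊔ 0` of a functional. -/
noncomputable def pos (f : DualLattice E) : DualLattice E :=
  LinearMap.mkContinuous
    { toFun := posFun f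
      map_add' := posFun_add f
      map_smul' := posFun_smul f } ‖f‖ (abs_posFun_le f)

theorem pos_apply (f : DualLattice E) {x : E} (hx : 0 ≤ x) : pos f x = posVal f x :=
  posFun_of_nonneg f hx

theorem le_add_pos_left (f g : DualLattice E) : f ≤ g + pos (f - g) := by
  intro x hx
  have := le_posVal (f - g) hx le_rfl
  rw [sub_apply] at this
  rw [add_apply, pos_apply _ hx]
  linarith

theorem le_add_pos_right (f g : DualLattice E) : g ≤ g + pos (f - g) := by
  intro x hx
  have := posVal_nonneg (f - g) hx
  rw [add_apply, pos_apply _ hx]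
  linarith

theorem add_pos_le (f g h : DualLattice E) (hf : f ≤ h) (hg : g ≤ h) :
    g + pos (f - g) ≤ h := by
  intro x hx
  rw [add_apply, pos_apply _ hx]
  have : posVal (f - g) x ≤ h x - g x := by
    refine posVal_le _ hx fun y h0 hy => ?_
    have h1 := hf y h0
    have h2 := hg (x - y) (sub_nonneg.2 hy)
    rw [map_sub, map_sub] at h2
    rw [sub_apply]
    linarith
  linarith

noncomputable instance : Lattice (DualLattice E) where
  sup f g := g + pos (f - g)
  le_sup_left := le_add_pos_left
  le_sup_right := le_add_pos_right
  sup_le f g h := add_pos_le f g h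
  inf f g := -(-g + pos (-f - -g))
  inf_le_left f g := neg_le.1 (le_add_pos_left (-f) (-g))
  inf_le_right f g := neg_le.1 (le_add_pos_right (-f) (-g))
  le_inf f g h hg hh := le_neg.1 (add_pos_le (-g) (-h) (-f) (neg_le_neg hg) (neg_le_neg hh))

theorem le_abs_apply (f : DualLattice E) (x : E) : |f x| ≤ |f| |x| := by
  have h1 : ∀ y : E, 0 ≤ y → f y ≤ |f| y := le_abs_self f
  have h2 : ∀ y : E, 0 ≤ y → -f y ≤ |f| y := neg_le_abs f
  have e : f x = f x⁺ - f x⁻ := by rw [← map_sub, posPart_sub_negPart]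
  have e2 : |f| |x| = |f| x⁺ + |f| x⁻ := by rw [← map_add, posPart_add_negPart]
  rw [e, e2, abs_le]
  have a1 := h1 _ (posPart_nonneg x)
  have a2 := h2 _ (posPart_nonneg x)
  have a3 := h1 _ (negPart_nonneg x)
  have a4 := h2 _ (negPart_nonneg x)
  constructor <;> linarith

theorem abs_apply_le_norm (g : DualLattice E) {a : E} (ha : 0 ≤ a) : |g| a ≤ ‖g‖ * ‖a‖ := by
  have e : |g| a = -g a + posVal (g - -g) a := by
    rw [← pos_apply _ ha]
    rfl
  have h : posVal (g - -g) a ≤ ‖g‖ * ‖a‖ + g a := by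
    refine posVal_le _ ha fun y h0 hy => ?_
    have h1 : g (y - (a - y)) ≤ ‖g‖ * ‖a‖ := by
      refine ((le_abs_self _).trans (abs_apply_le g _)).trans
        (mul_le_mul_of_nonneg_left ?_ (norm_nonneg g))
      refine norm_le_norm_of_abs_le_abs ?_
      rw [abs_of_nonneg ha]
      have hay : 0 ≤ a - y := sub_nonneg.2 hy
      refine abs_le'.2 ⟨?_, ?_⟩
      · exact (sub_le_self y hay).trans hy
      · rw [neg_sub]
        exact (sub_le_self _ h0).trans (sub_le_self _ h0)
    rw [map_sub, map_sub] at h1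
    rw [sub_apply, neg_apply]
    linarith
  rw [e]
  linarith

instance : HasSolidNorm (DualLattice E) where
  solid f g h := by
    refine ContinuousLinearMap.opNorm_le_bound _ (norm_nonneg g) fun x => ?_
    have h1 := le_abs_apply f x
    have h2 : |f| |x| ≤ |g| |x| := h |x| (abs_nonneg x)
    have h3 := abs_apply_le_norm g (abs_nonneg x)
    rw [norm_abs_eq_norm] at h3
    exact (h1.trans h2).trans h3

instance : IsOrderedModule ℝ (DualLattice E) where
  smul_le_smul_of_nonneg_left c hc f g h x hx := by
    simp only [smul_apply]
    exact mul_le_mul_of_nonneg_left (h x hx) hc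
  smul_le_smul_of_nonneg_right f hf c d h x hx := by
    simp only [smul_apply]
    exact mul_le_mul_of_nonneg_right h (hf x hx)

/-- The canonical embedding of `E` into its bidual. -/
noncomputable def toBidual : E →L[ℝ] DualLattice (DualLattice E) :=
  NormedSpace.inclusionInDoubleDual ℝ E

theorem toBidual_apply (x : E) (f : DualLattice E) : toBidual x f = f x := rfl

end Order

end DualLattice

/-! ### Complex Banach lattices -/

/-- The complexification `E + iE` of a real Banach lattice `E`. -/
@[ext]
structure Complexification (E : Type u) : Type u where
  re : E
  im : E

namespace Complexification

section Algebra

variable {E : Type u} [AddCommGroup E]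

instance : Zero (Complexification E) := ⟨⟨0, 0⟩⟩
instance : Add (Complexification E) := ⟨fun z w => ⟨z.re + w.re, z.im + w.im⟩⟩
instance : Neg (Complexification E) := ⟨fun z => ⟨-z.re, -z.im⟩⟩

@[simp] theorem zero_re : (0 : Complexification E).re = 0 := rfl
@[simp] theorem zero_im : (0 : Complexification E).im = 0 := rfl
@[simp] theorem add_re (z w : Complexification E) : (z + w).re = z.re + w.re := rfl
@[simp] theorem add_im (z w : Complexification E) : (z + w).im = z.im + w.im := rfl
@[simp] theorem neg_re (z : Complexification E) : (-z).re = -z.re := rfl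
@[simp] theorem neg_im (z : Complexification E) : (-z).im = -z.im := rfl

instance : AddCommGroup (Complexification E) where
  add_assoc x y z := by ext <;> simp [add_assoc]
  zero_add x := by ext <;> simp
  add_zero x := by ext <;> simp
  add_comm x y := by ext <;> simp [add_comm]
  neg_add_cancel x := by ext <;> simp
  nsmul := nsmulRec
  zsmul := zsmulRec

variable [Module ℝ E]

instance : SMul ℂ (Complexification E) :=
  ⟨fun c z => ⟨c.re • z.re - c.im • z.im, c.re • z.im + c.im • z.re⟩⟩

@[simp] theorem smul_re (c : ℂ) (z : Complexification E) :
    (c • z).re = c.re • z.re - c.im • z.im := rfl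
@[simp] theorem smul_im (c : ℂ) (z : Complexification E) :
    (c • z).im = c.re • z.im + c.im • z.re := rfl

instance : Module ℂ (Complexification E) where
  one_smul z := by ext <;> simp
  mul_smul c d z := by
    ext
    · simp only [smul_re, smul_im, Complex.mul_re, Complex.mul_im]; module
    · simp only [smul_re, smul_im, Complex.mul_re, Complex.mul_im]; module
  smul_zero c := by ext <;> simp
  smul_add c z w := by
    ext
    · simp only [smul_re, add_re, add_im]; module
    · simp only [smul_im, add_re, add_im]; module
  add_smul c d z := by
    ext
    · simp only [smul_re, add_re, Complex.add_re, Complex.add_im]; module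
    · simp only [smul_im, add_im, Complex.add_re, Complex.add_im]; module
  zero_smul z := by ext <;> simp

end Algebra

section Norm

variable {E : Type u} [NormedAddCommGroup E] [NormedSpace ℝ E] [Lattice E] [IsOrderedAddMonoid E]
  [HasSolidNorm E] [IsOrderedModule ℝ E] [CompleteSpace E]

/-- The modulus `|a + ib| = (|a|² + |b|²)^{1/2}`. -/
noncomputable def modulus (z : Complexification E) : E := lpSum 2 ![z.re, z.im]

theorem mem_conjBall_two {a : Fin 2 → ℝ} : a ∈ conjBall 2 2 ↔ a 0 ^ 2 + a 1 ^ 2 ≤ 1 := by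
  have h2 : ENNReal.conjExponent 2 = 2 := by
    have : ENNReal.HolderConjugate 2 2 := inferInstance
    exact ENNReal.HolderConjugate.conjExponent_eq
  unfold conjBall
  rw [Set.mem_ofPred_eq, h2, EuclideanSpace.norm_eq, Real.sqrt_le_one]
  simp [Fin.sum_univ_two]

/-- `|z|` is the least upper bound of `Re (c z)`, `|c| ≤ 1`. -/
theorem isLUB_modulus (z : Complexification E) :
    IsLUB ((fun c : ℂ => (c • z).re) '' Metric.closedBall 0 1) (modulus z) := by
  have h := isLUB_lpSum 2 ![z.re, z.im]
  convert! h using 1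
  ext y
  simp only [Set.mem_image, mem_closedBall_zero_iff, mem_conjBall_two, Fin.sum_univ_two]
  have hn : ∀ c : ℂ, ‖c‖ ≤ 1 ↔ c.re ^ 2 + c.im ^ 2 ≤ 1 := by
    intro c
    rw [← sq_le_one_iff₀ (norm_nonneg c), Complex.sq_norm, Complex.normSq_apply]
    simp [sq]
  constructor
  · rintro ⟨c, hc, rfl⟩
    refine ⟨![c.re, -c.im], ?_, ?_⟩
    · simpa using (hn c).1 hc
    · simp [sub_eq_add_neg]
  · rintro ⟨a, ha, rfl⟩
    refine ⟨⟨a 0, -a 1⟩, ?_, ?_⟩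
    · rw [hn]; simpa using ha
    · simp

theorem re_smul_le_modulus {c : ℂ} (hc : ‖c‖ ≤ 1) (z : Complexification E) :
    (c • z).re ≤ modulus z :=
  (isLUB_modulus z).1 ⟨c, by simpa using hc, rfl⟩

theorem modulus_le {z : Complexification E} {b : E}
    (h : ∀ c : ℂ, ‖c‖ ≤ 1 → (c • z).re ≤ b) : modulus z ≤ b :=
  (isLUB_modulus z).2 (by rintro _ ⟨c, hc, rfl⟩; exact h c (by simpa using hc))

theorem modulus_nonneg (z : Complexification E) : 0 ≤ modulus z := by
  simpa using re_smul_le_modulus (c := 0) (by simp) z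

theorem abs_re_le_modulus (z : Complexification E) : |z.re| ≤ modulus z := by
  refine abs_le'.2 ⟨?_, ?_⟩
  · simpa using re_smul_le_modulus (c := 1) (by simp) z
  · simpa using re_smul_le_modulus (c := -1) (by simp) z

theorem abs_im_le_modulus (z : Complexification E) : |z.im| ≤ modulus z := by
  refine abs_le'.2 ⟨?_, ?_⟩
  · simpa using re_smul_le_modulus (c := -Complex.I) (by simp) z
  · simpa using re_smul_le_modulus (c := Complex.I) (by simp) z

theorem modulus_add_le (z w : Complexification E) : modulus (z + w) ≤ modulus z + modulus w := by
  refine modulus_le fun c hc => ?_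
  rw [smul_add, add_re]
  exact add_le_add (re_smul_le_modulus hc z) (re_smul_le_modulus hc w)

theorem modulus_zero : modulus (0 : Complexification E) = 0 :=
  le_antisymm (modulus_le fun c _ => by simp) (modulus_nonneg _)

theorem modulus_smul_le (d : ℂ) (z : Complexification E) : modulus (d • z) ≤ ‖d‖ • modulus z := by
  rcases eq_or_ne d 0 with rfl | hd
  · simp [modulus_zero]
  refine modulus_le fun c hc => ?_
  have hd' : (‖d‖ : ℂ) ≠ 0 := by simpa using hd
  have h := re_smul_le_modulus (c := c * d / (‖d‖ : ℂ)) (by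
    rw [norm_div, norm_mul, Complex.norm_real, norm_norm,
      mul_div_cancel_right₀ _ (norm_ne_zero_iff.2 hd)]
    exact hc) z
  have h2 := smul_le_smul_of_nonneg_left h (norm_nonneg d)
  have e : ∀ (r : ℝ) (w : Complexification E), r • w.re = ((r : ℂ) • w).re := by
    intro r w; rw [smul_re]; simp
  rw [e, smul_smul, mul_div_cancel₀ _ hd'] at h2
  rwa [smul_smul]

theorem modulus_smul (d : ℂ) (z : Complexification E) : modulus (d • z) = ‖d‖ • modulus z := by
  rcases eq_or_ne d 0 with rfl | hd
  · simp [modulus_zero]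
  refine le_antisymm (modulus_smul_le d z) ?_
  have h := modulus_smul_le d⁻¹ (d • z)
  rw [inv_smul_smul₀ hd, norm_inv] at h
  have h2 := smul_le_smul_of_nonneg_left h (norm_nonneg d)
  rwa [smul_inv_smul₀ (norm_ne_zero_iff.2 hd)] at h2

/-- The norm of a complex Banach lattice: `‖z‖ = ‖ |z| ‖`. -/
noncomputable instance : Norm (Complexification E) := ⟨fun z => ‖modulus z‖⟩

theorem norm_def (z : Complexification E) : ‖z‖ = ‖modulus z‖ := rfl

theorem normedSpaceCore : NormedSpace.Core ℂ (Complexification E) where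
  norm_nonneg z := norm_nonneg (modulus z)
  norm_smul c z := by
    rw [norm_def, modulus_smul, norm_smul, norm_norm, norm_def]
  norm_triangle z w := by
    rw [norm_def, norm_def, norm_def]
    exact (norm_le_of_nonneg_of_le (modulus_nonneg _) (modulus_add_le z w)).trans
      (norm_add_le _ _)
  norm_eq_zero_iff z := by
    rw [norm_def, norm_eq_zero]
    constructor
    · intro h
      have h1 := abs_re_le_modulus z
      have h2 := abs_im_le_modulus z
      rw [h] at h1 h2
      have a1 : z.re = 0 := le_antisymm ((le_abs_self _).trans h1)
        (neg_nonpos.1 ((neg_le_abs _).trans h1))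
      have a2 : z.im = 0 := le_antisymm ((le_abs_self _).trans h2)
        (neg_nonpos.1 ((neg_le_abs _).trans h2))
      ext
      · exact a1
      · exact a2
    · rintro rfl
      exact modulus_zero

noncomputable instance : NormedAddCommGroup (Complexification E) :=
  NormedAddCommGroup.ofCore normedSpaceCore

noncomputable instance : NormedSpace ℂ (Complexification E) :=
  NormedSpace.ofCore normedSpaceCore

/-- The canonical embedding of `E + iE` into `E** + iE**`. -/
noncomputable def toBidual (z : Complexification E) :
    Complexification (DualLattice (DualLattice E)) :=
  ⟨DualLattice.toBidual z.re, DualLattice.toBidual z.im⟩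

end Norm

end Complexification

/-! ### Regular operators, convexity and concavity -/

/-- A modulus `x ↦ |x|` on `X` with values in the real lattice `E`. It serves real Banach lattices,
complex Banach lattices, and subspaces of either, by the three instances below. -/
class HasModulus (X : Type u) (E : outParam (Type v)) where
  modulus : X → E

instance HasModulus.ofLattice {E : Type u} [AddCommGroup E] [Lattice E] : HasModulus E E :=
  ⟨fun x => |x|⟩

noncomputable instance HasModulus.ofComplexification {E : Type u} [NormedAddCommGroup E]
    [NormedSpace ℝ E] [Lattice E] [IsOrderedAddMonoid E] [HasSolidNorm E] [IsOrderedModule ℝ E]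
    [CompleteSpace E] : HasModulus (Complexification E) E :=
  ⟨Complexification.modulus⟩

instance HasModulus.ofSubmodule {𝕜 : Type w} {X : Type u} {E : Type v} [Semiring 𝕜]
    [AddCommMonoid X] [Module 𝕜 X] [HasModulus X E] (S : Submodule 𝕜 X) : HasModulus S E :=
  ⟨fun s => HasModulus.modulus (s : X)⟩

/-- `‖sup_{i ≤ m} |u (x i)|‖ ≤ C ‖sup_{i ≤ m} |x i|‖` for all nonempty finite sequences `x`. -/
def HasRegularBound {X Y E F : Type*} [HasModulus X E] [Norm E] [Lattice E]
    [HasModulus Y F] [Norm F] [Lattice F] (T : X → Y) (C : ℝ) : Prop :=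
  0 ≤ C ∧ ∀ (m : ℕ) (x : Fin (m + 1) → X),
    ‖Finset.univ.sup' Finset.univ_nonempty fun i => HasModulus.modulus (T (x i))‖ ≤
      C * ‖Finset.univ.sup' Finset.univ_nonempty fun i => HasModulus.modulus (x i)‖

/-- Regular operators. -/
def IsRegularOp {X Y E F : Type*} [HasModulus X E] [Norm E] [Lattice E]
    [HasModulus Y F] [Norm F] [Lattice F] (T : X → Y) : Prop :=
  ∃ C, HasRegularBound T C

/-- The regular norm `‖T‖_r` of a regular operator. -/
noncomputable def regularNorm {X Y E F : Type*} [HasModulus X E] [Norm E] [Lattice E]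
    [HasModulus Y F] [Norm F] [Lattice F] (T : X → Y) : ℝ :=
  sInf {C | HasRegularBound T C}

section Convexity

variable {E : Type u} [NormedAddCommGroup E] [NormedSpace ℝ E] [Lattice E] [IsOrderedAddMonoid E]
  [HasSolidNorm E] [IsOrderedModule ℝ E] [CompleteSpace E]

/-- `p`-convexity (with constant `1`):
`‖(∑ |x i| ^ p) ^ (1/p)‖ ≤ (∑ ‖x i‖ ^ p) ^ (1/p)`, with maxima instead of sums if `p = ∞`. -/
def IsPConvex (p : ℝ≥0∞) (X : Type v) [Norm X] [HasModulus X E] : Prop :=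
  ∀ (n : ℕ) (x : Fin n → X),
    ‖lpSum p fun i => HasModulus.modulus (x i)‖ ≤ ‖WithLp.toLp p fun i => ‖x i‖‖

/-- `p`-concavity (with constant `1`):
`(∑ ‖x i‖ ^ p) ^ (1/p) ≤ ‖(∑ |x i| ^ p) ^ (1/p)‖`, with maxima instead of sums if `p = ∞`. -/
def IsPConcave (p : ℝ≥0∞) (X : Type v) [Norm X] [HasModulus X E] : Prop :=
  ∀ (n : ℕ) (x : Fin n → X),
    ‖WithLp.toLp p fun i => ‖x i‖‖ ≤ ‖lpSum p fun i => HasModulus.modulus (x i)‖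

end Convexity

/-- `L` is, isometrically and as a lattice, the dual of a Banach lattice `M`. -/
def IsDualLattice (L : Type v) [NormedAddCommGroup L] [NormedSpace ℝ L] [Lattice L] : Prop :=
  ∃ (M : Type w) (_ : NormedAddCommGroup M) (_ : NormedSpace ℝ M) (_ : Lattice M)
    (_ : IsOrderedAddMonoid M) (_ : HasSolidNorm M) (_ : IsOrderedModule ℝ M)
    (_ : CompleteSpace M) (e : L ≃ₗᵢ[ℝ] DualLattice M), ∀ x y : L, e x ≤ e y ↔ x ≤ y

end BanachLat

open BanachLat

/-! An operator `T : S → L` corresponds to the bilinear form `(s, η) ↦ η (T s)` on `S × L*`.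
Extending `T` with values in `L**` amounts to extending this form to `X × L*`, where `X` is the
whole space. This is done by Hahn–Banach on `X ⊗ L*`. The sublinear majorant is `C` times the gauge
of the convex hull of `tensorAtoms`, chosen so that, by the Riesz–Kantorovich formula, a form below
it comes from an operator `X → L**` with regular bound `C` (`exists_bidual_extension`). A projection
`P : L** → L` of regular norm at most `1` then leads back to `L`.

The point is that the form is at most `C` on tensors of `S ⊗ L*` in the hull, although the hull uses
vectors outside `S` (`sum_apply_le_of_convex_combination`). Convexity and concavity merge a convex
combination with weights `c k` and bounds `e k`, `h k` into one pair. Split `c k = c k ^ (1/p) * c k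
^ (1/q)`. The `p`-sum `X₀` of the `c k ^ (1/p) • e k` has norm at most `1` by `p`-convexity. The `c
k ^ (1/q) • h k` have an upper bound `H` for their `q`-sum with norm at most `1 + δ`, by the dual
form of `p`-concavity (`IsPConcave.exists_dual_bound`).

If `L*` consisted of functions, evaluating the second factor at a point `φ` would turn the tensor
into a vector of `S` with modulus at most `φ(H) X₀`. Regularity dominates the images of these
vectors by `φ(H) V` with one `V` of norm at most `C`, and integrating over the points bounds the
form by `H(V) ≤ (1 + δ) C`. The points are real lattice homomorphisms on a principal ideal of `L*`
(`IsMaxSublinear.exists_linear`), and the integral is a sum over a finite partition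
(`exists_partition`).

Real and complex scalars share this argument: `X` is only a real vector space with a lattice-valued
modulus `m`, and a complex operator is recovered from its real part (`ofRealPart`). -/

namespace BanachLat

/-! ### Lattice homomorphisms into the reals -/

/-- Sublinear functionals that turn the binary operation `j` into the maximum. -/
structure IsMaxSublinear {V : Type u} [AddCommGroup V] [Module ℝ V] (j : V → V → V)
    (q : V → ℝ) : Prop where
  add_le : ∀ x y, q (x + y) ≤ q x + q y
  smul_le : ∀ t : ℝ, 0 < t → ∀ x, q (t • x) ≤ t * q x
  map_join : ∀ x y, q (j x y) = max (q x) (q y)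

namespace IsMaxSublinear

variable {V : Type u} [AddCommGroup V] [Module ℝ V] {j : V → V → V} {q : V → ℝ}

theorem map_smul_of_pos (hq : IsMaxSublinear j q) {t : ℝ} (ht : 0 < t) (x : V) :
    q (t • x) = t * q x := by
  refine le_antisymm (hq.smul_le t ht x) ?_
  have h := hq.smul_le t⁻¹ (inv_pos.2 ht) (t • x)
  rw [inv_smul_smul₀ ht.ne'] at h
  have := mul_le_mul_of_nonneg_left h ht.le
  rwa [mul_inv_cancel_left₀ ht.ne'] at this

theorem map_zero (hq : IsMaxSublinear j q) : q 0 = 0 := by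
  have h := hq.map_smul_of_pos two_pos 0
  rw [smul_zero] at h
  linarith

theorem map_smul_of_nonneg (hq : IsMaxSublinear j q) {t : ℝ} (ht : 0 ≤ t) (x : V) :
    q (t • x) = t * q x := by
  rcases ht.eq_or_lt with rfl | ht
  · rw [zero_smul, zero_mul, hq.map_zero]
  · exact hq.map_smul_of_pos ht x

theorem neg_map_neg_le (hq : IsMaxSublinear j q) (x : V) : -q (-x) ≤ q x := by
  have := hq.add_le x (-x)
  rw [add_neg_cancel, hq.map_zero] at this
  linarith

/-- `shift q a t y = q (y + t a) - t q(a)`, a decreasing function of `t`. -/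
def shift (q : V → ℝ) (a : V) (t : NNReal) (y : V) : ℝ := q (y + (t : ℝ) • a) - t * q a

/-- For `s ≤ t`, subadditivity gives `q (y + t a) ≤ q (y + s a) + (t - s) q(a)`. -/
theorem antitone_shift (hq : IsMaxSublinear j q) (a y : V) :
    Antitone fun t => shift q a t y := by
  intro s t hst
  have h := hq.add_le (y + (s : ℝ) • a) (((t : ℝ) - s) • a)
  rw [hq.map_smul_of_nonneg (sub_nonneg.2 (by exact_mod_cast hst))] at h
  have e : y + (s : ℝ) • a + ((t : ℝ) - s) • a = y + (t : ℝ) • a := by module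
  rw [e] at h
  simp only [shift]
  linarith

theorem le_shift (hq : IsMaxSublinear j q) (a y : V) (t : NNReal) :
    -q (-y) ≤ shift q a t y := by
  have h := hq.add_le (y + (t : ℝ) • a) (-y)
  rw [add_neg_cancel_comm, hq.map_smul_of_nonneg t.coe_nonneg] at h
  simp only [shift]
  linarith

theorem bddBelow_shift (hq : IsMaxSublinear j q) (a y : V) :
    BddBelow (Set.range fun t => shift q a t y) :=
  ⟨-q (-y), by rintro _ ⟨t, rfl⟩; exact hq.le_shift a y t⟩

/-- Subadditivity combines the parameters `s` and `t` into `s + t`; homogeneity rescales the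
parameter. Joins commute with translations, so every single shift preserves them, and monotonicity
in `t` lets the maximum pass through the infimum. -/
theorem iInf_shift (hj : ∀ x y z, j x y + z = j (x + z) (y + z)) (hq : IsMaxSublinear j q)
    (a : V) : IsMaxSublinear j fun y => ⨅ t, shift q a t y where
  add_le x y := by
    refine le_ciInf_add_ciInf fun s t => ?_
    refine (ciInf_le (hq.bddBelow_shift a _) (s + t)).trans ?_
    have h := hq.add_le (x + (s : ℝ) • a) (y + (t : ℝ) • a)
    have e : x + (s : ℝ) • a + (y + (t : ℝ) • a) = x + y + ((s + t : NNReal) : ℝ) • a := by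
      push_cast; module
    rw [e] at h
    simp only [shift]
    push_cast at h ⊢
    linarith
  smul_le c hc x := by
    rw [Real.mul_iInf_of_nonneg hc.le]
    lift c to NNReal using hc.le
    refine le_ciInf fun t => ?_
    refine (ciInf_le (hq.bddBelow_shift a _) (c * t)).trans (le_of_eq ?_)
    have e : (c : ℝ) • x + ((c * t : NNReal) : ℝ) • a = (c : ℝ) • (x + (t : ℝ) • a) := by
      rw [NNReal.coe_mul]; module
    simp only [shift]
    rw [e, hq.map_smul_of_pos hc, NNReal.coe_mul]
    ring
  map_join x y := by
    have key : ∀ t, shift q a t (j x y) = max (shift q a t x) (shift q a t y) := by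
      intro t
      simp only [shift]
      rw [hj, hq.map_join, max_sub_sub_right]
    refine le_antisymm ?_ (max_le ?_ ?_)
    · refine le_of_forall_pos_le_add fun ε hε => ?_
      obtain ⟨s, hs⟩ := exists_lt_of_ciInf_lt (lt_add_of_pos_right (⨅ t, shift q a t x) hε)
      obtain ⟨t, ht⟩ := exists_lt_of_ciInf_lt (lt_add_of_pos_right (⨅ t, shift q a t y) hε)
      refine (ciInf_le (hq.bddBelow_shift a _) (max s t)).trans ?_
      rw [key, ← max_add_add_right]
      exact max_le_max ((hq.antitone_shift a x (le_max_left s t)).trans hs.le)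
        ((hq.antitone_shift a y (le_max_right s t)).trans ht.le)
    · refine ciInf_mono (hq.bddBelow_shift a x) fun t => ?_
      rw [key]; exact le_max_left _ _
    · refine ciInf_mono (hq.bddBelow_shift a y) fun t => ?_
      rw [key]; exact le_max_right _ _

theorem iInf_shift_le (hq : IsMaxSublinear j q) (a y : V) : ⨅ t, shift q a t y ≤ q y := by
  refine (ciInf_le (hq.bddBelow_shift a y) 0).trans ?_
  simp [shift]

/-- The parameter `t = 1` suffices. This pushes the value at `-a` down to `-q a`, which is what
makes minimal functionals linear. -/
theorem iInf_shift_neg_le (hq : IsMaxSublinear j q) (a : V) :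
    ⨅ t, shift q a t (-a) ≤ -q a := by
  refine (ciInf_le (hq.bddBelow_shift a (-a)) 1).trans ?_
  simp [shift, hq.map_zero]

/-- Supplies the lower bounds for Zorn's lemma. Near-minimisers at two different points can be
replaced by the smaller of the two, since they lie in a chain. -/
theorem iInf_chain {c : Set (V → ℝ)} (hc : IsChain (· ≤ ·) c) (hne : c.Nonempty)
    (hcq : ∀ f ∈ c, IsMaxSublinear j f) (hb : ∀ x, BddBelow (Set.range fun f : c => f.1 x)) :
    IsMaxSublinear j fun x => ⨅ f : c, f.1 x := by
  have : Nonempty c := hne.to_subtype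
  have hmin : ∀ f g : c, ∃ h : c, h.1 ≤ f.1 ∧ h.1 ≤ g.1 := by
    intro f g
    rcases hc.total f.2 g.2 with h | h
    · exact ⟨f, le_rfl, h⟩
    · exact ⟨g, h, le_rfl⟩
  refine ⟨fun x y => ?_, fun t ht x => ?_, fun x y => ?_⟩
  · refine le_ciInf_add_ciInf fun f g => ?_
    obtain ⟨h, hf, hg⟩ := hmin f g
    refine (ciInf_le (hb _) h).trans (((hcq _ h.2).add_le x y).trans ?_)
    exact add_le_add (hf x) (hg y)
  · rw [Real.mul_iInf_of_nonneg ht.le]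
    exact ciInf_mono (hb _) fun f => (hcq _ f.2).smul_le t ht x
  · refine le_antisymm ?_ (max_le ?_ ?_)
    · refine le_of_forall_pos_le_add fun ε hε => ?_
      obtain ⟨f, hf⟩ := exists_lt_of_ciInf_lt (lt_add_of_pos_right (⨅ f : c, f.1 x) hε)
      obtain ⟨g, hg⟩ := exists_lt_of_ciInf_lt (lt_add_of_pos_right (⨅ f : c, f.1 y) hε)
      obtain ⟨h, h1, h2⟩ := hmin f g
      refine (ciInf_le (hb _) h).trans ?_
      rw [(hcq _ h.2).map_join, ← max_add_add_right]
      exact max_le_max ((h1 x).trans hf.le) ((h2 y).trans hg.le)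
    · refine ciInf_mono (hb _) fun f => ?_
      rw [(hcq _ f.2).map_join]; exact le_max_left _ _
    · refine ciInf_mono (hb _) fun f => ?_
      rw [(hcq _ f.2).map_join]; exact le_max_right _ _

/-- A sublinear functional that preserves joins dominates a linear one that preserves joins, with
equality at a given point. -/
theorem exists_linear (hj : ∀ x y z, j x y + z = j (x + z) (y + z)) (hq : IsMaxSublinear j q)
    (a : V) : ∃ φ : V →ₗ[ℝ] ℝ, (∀ x, φ x ≤ q x) ∧ φ a = q a ∧
      ∀ x y, φ (j x y) = max (φ x) (φ y) := by
  -- Searching below `q₁` instead of `q` secures equality at `a`: a linear functional below `q₁` is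
  -- at most `-q a` at `-a`, hence at least `q a` at `a`.
  set q₁ : V → ℝ := fun y => ⨅ t, shift q a t y with hq₁
  have hm₁ : IsMaxSublinear j q₁ := hq.iInf_shift hj a
  -- The order dual makes the maximal element of Zorn's lemma a minimal functional.
  obtain ⟨m, hmle, hmax⟩ := @zorn_le_nonempty₀ (V → ℝ)ᵒᵈ _
    {f : (V → ℝ) | IsMaxSublinear j f ∧ f ≤ q₁} (by
      intro c hcs hc f hf
      have hcq : ∀ g : V → ℝ, g ∈ c → IsMaxSublinear j g := fun g hg => (hcs hg).1
      have hcle : ∀ g : V → ℝ, g ∈ c → g ≤ q₁ := fun g hg => (hcs hg).2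
      have hb : ∀ x, BddBelow (Set.range fun g : c => (g.1 : V → ℝ) x) := by
        intro x
        refine ⟨-q₁ (-x), ?_⟩
        rintro _ ⟨g, rfl⟩
        exact (neg_le_neg (hcle _ g.2 (-x))).trans ((hcq _ g.2).neg_map_neg_le x)
      have hle : ∀ g : V → ℝ, ∀ hg : g ∈ c, (fun x => ⨅ g : c, (g.1 : V → ℝ) x) ≤ g :=
        fun g hg x => ciInf_le (hb x) ⟨g, hg⟩
      refine ⟨fun x => ⨅ g : c, (g.1 : V → ℝ) x, ⟨?_, ?_⟩, hle⟩
      · exact iInf_chain (c := c) hc.symm ⟨f, hf⟩ hcq hb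
      · exact (hle f hf).trans (hcle f hf)) q₁ ⟨hm₁, le_rfl⟩
  change V → ℝ at m
  have hms : IsMaxSublinear j m := hmax.prop.1
  have hmq : m ≤ q₁ := hmax.prop.2
  have hneg : ∀ x, m (-x) = -m x := by
    intro x
    -- The infimum of the shifts of `m` lies below `m`, so minimality makes them equal, and `m (-x)
    -- ≤ -m x` follows.
    have h1 : IsMaxSublinear j fun y => ⨅ t, shift m x t y := hms.iInf_shift hj x
    have h2 : (fun y => ⨅ t, shift m x t y) ≤ m := hms.iInf_shift_le x
    have h3 : m ≤ fun y => ⨅ t, shift m x t y := hmax.2 ⟨h1, h2.trans hmq⟩ h2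
    refine le_antisymm ((h3 (-x)).trans (hms.iInf_shift_neg_le x)) ?_
    have := hms.neg_map_neg_le x
    linarith
  have hadd : ∀ x y, m (x + y) = m x + m y := by
    intro x y
    refine le_antisymm (hms.add_le x y) ?_
    have h := hms.add_le (-x) (-y)
    rw [← neg_add, hneg, hneg, hneg] at h
    linarith
  have hsmul : ∀ (c : ℝ) x, m (c • x) = c * m x := by
    intro c x
    rcases le_total 0 c with hc | hc
    · exact hms.map_smul_of_nonneg hc x
    · have h := hms.map_smul_of_nonneg (neg_nonneg.2 hc) x
      rw [neg_smul, hneg] at h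
      linarith
  have hqq : ∀ x, q₁ x ≤ q x := hq.iInf_shift_le a
  refine ⟨{ toFun := m, map_add' := hadd, map_smul' := hsmul }, fun x => (hmq x).trans (hqq x),
    le_antisymm ((hmq a).trans (hqq a)) ?_, hms.map_join⟩
  have h := (hmq (-a)).trans (hq.iInf_shift_neg_le a)
  rw [hneg] at h
  change q a ≤ m a
  linarith

end IsMaxSublinear

/-! ### Real lattice homomorphisms on a principal ideal. -/

section Characters

variable {G : Type u} [AddCommGroup G] [Module ℝ G] [Lattice G] [IsOrderedAddMonoid G]
  [IsOrderedModule ℝ G]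

/-- The ideal generated by `ω`. -/
def principalIdeal (ω : G) : Submodule ℝ G where
  carrier := {x | ∃ c : ℝ, |x| ≤ c • ω}
  add_mem' := by
    rintro x y ⟨c, hc⟩ ⟨d, hd⟩
    exact ⟨c + d, by rw [add_smul]; exact (abs_add_le x y).trans (add_le_add hc hd)⟩
  zero_mem' := ⟨0, by simp⟩
  smul_mem' := by
    rintro t x ⟨c, hc⟩
    refine ⟨|t| * c, ?_⟩
    rw [mul_smul]
    refine le_trans ?_ (smul_le_smul_of_nonneg_left hc (abs_nonneg t))
    refine abs_le'.2 ⟨?_, ?_⟩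
    · rcases abs_cases t with ⟨h, _⟩ | ⟨h, _⟩
      · rw [h]; exact smul_le_smul_of_nonneg_left (le_abs_self x) (by linarith)
      · rw [h, ← neg_smul_neg]; exact smul_le_smul_of_nonneg_left (neg_le_abs x) (by linarith)
    · rcases abs_cases t with ⟨h, _⟩ | ⟨h, _⟩
      · rw [h, ← smul_neg]; exact smul_le_smul_of_nonneg_left (neg_le_abs x) (by linarith)
      · rw [h, ← neg_smul]; exact smul_le_smul_of_nonneg_left (le_abs_self x) (by linarith)

theorem abs_mem_principalIdeal {ω x : G} (hx : x ∈ principalIdeal ω) :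
    |x| ∈ principalIdeal ω := by
  obtain ⟨c, hc⟩ := hx
  exact ⟨c, by rwa [abs_abs]⟩

theorem mem_principalIdeal_of_abs_le {ω x y : G} (h : |x| ≤ y) (hy : y ∈ principalIdeal ω) :
    x ∈ principalIdeal ω := by
  obtain ⟨c, hc⟩ := hy
  exact ⟨c, h.trans ((le_abs_self y).trans hc)⟩

theorem sup_mem_principalIdeal {ω x y : G} (hx : x ∈ principalIdeal ω)
    (hy : y ∈ principalIdeal ω) : x ⊔ y ∈ principalIdeal ω := by
  refine mem_principalIdeal_of_abs_le (y := |x| + |y|) (abs_le'.2 ⟨?_, ?_⟩)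
    (add_mem (abs_mem_principalIdeal hx) (abs_mem_principalIdeal hy))
  · exact sup_le ((le_abs_self x).trans (le_add_of_nonneg_right (abs_nonneg y)))
      ((le_abs_self y).trans (le_add_of_nonneg_left (abs_nonneg x)))
  · refine (neg_le_neg (le_sup_left : x ≤ x ⊔ y)).trans ?_
    exact (neg_le_abs x).trans (le_add_of_nonneg_right (abs_nonneg y))

theorem inf_mem_principalIdeal {ω x y : G} (hx : x ∈ principalIdeal ω)
    (hy : y ∈ principalIdeal ω) : x ⊓ y ∈ principalIdeal ω := by
  have h := neg_mem (sup_mem_principalIdeal (neg_mem hx) (neg_mem hy))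
  rwa [neg_sup, neg_neg, neg_neg] at h

/-- A linear functional that is a lattice homomorphism on the ideal generated by `ω`, with value
`1` at `ω`. -/
structure IsCharacter (ω : G) (φ : G →ₗ[ℝ] ℝ) : Prop where
  map_unit : φ ω = 1
  map_sup : ∀ x ∈ principalIdeal ω, ∀ y ∈ principalIdeal ω, φ (x ⊔ y) = max (φ x) (φ y)

namespace IsCharacter

variable {ω : G} {φ : G →ₗ[ℝ] ℝ}

theorem mono (hφ : IsCharacter ω φ) {x y : G} (hx : x ∈ principalIdeal ω)
    (hy : y ∈ principalIdeal ω) (h : x ≤ y) : φ x ≤ φ y := by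
  have := hφ.map_sup x hx y hy
  rw [sup_eq_right.2 h] at this
  rw [this]
  exact le_max_left _ _

theorem nonneg (hφ : IsCharacter ω φ) {x : G} (hx : x ∈ principalIdeal ω) (h : 0 ≤ x) :
    0 ≤ φ x := by
  simpa using hφ.mono (zero_mem _) hx h

theorem map_abs (hφ : IsCharacter ω φ) {x : G} (hx : x ∈ principalIdeal ω) :
    φ |x| = |φ x| := by
  rw [abs, hφ.map_sup x hx (-x) (neg_mem hx), map_neg, abs_eq_max_neg]

theorem map_inf (hφ : IsCharacter ω φ) {x y : G} (hx : x ∈ principalIdeal ω)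
    (hy : y ∈ principalIdeal ω) : φ (x ⊓ y) = min (φ x) (φ y) := by
  have h := hφ.map_sup (-x) (neg_mem hx) (-y) (neg_mem hy)
  rw [← neg_inf, map_neg, map_neg, map_neg, max_neg_neg] at h
  linarith

end IsCharacter

/-- Characters determine the order of the ideal generated by `ω`. -/
theorem le_zero_of_forall_isCharacter {ω : G} (hω : 0 ≤ ω)
    (harch : ∀ x : G, (∀ ε : ℝ, 0 < ε → x ≤ ε • ω) → x ≤ 0) {x : G}
    (hx : x ∈ principalIdeal ω) (h : ∀ φ, IsCharacter ω φ → φ x ≤ 0) : x ≤ 0 := by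
  by_contra hx0
  set I := principalIdeal ω with hI
  -- The one-sided gauge of the order unit. It turns joins into maxima because `y ⊔ z ≤ c • ω` holds
  -- exactly when both terms satisfy the bound.
  set q : I → ℝ := fun y => sInf {c : ℝ | (y : G) ≤ c • ω} with hq
  -- A negative `c` would force `ω = 0`, hence `x ≤ 0`.
  have hωpos : ∀ c : ℝ, 0 ≤ c • ω → 0 ≤ c := by
    intro c hc
    by_contra hneg
    push Not at hneg
    have h0 : ω ≤ 0 := by
      have := smul_le_smul_of_nonneg_left hc (inv_nonneg.2 (neg_nonneg.2 hneg.le))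
      rw [smul_zero, smul_smul, inv_neg, neg_mul, inv_mul_cancel₀ hneg.ne, neg_one_smul] at this
      exact neg_nonneg.1 this
    obtain ⟨d, hd⟩ := hx
    rw [le_antisymm h0 hω, smul_zero] at hd
    exact hx0 ((le_abs_self x).trans hd)
  have hmono : ∀ c d : ℝ, c ≤ d → c • ω ≤ d • ω := fun c d hcd =>
    smul_le_smul_of_nonneg_right hcd hω
  have hne : ∀ y : I, {c : ℝ | (y : G) ≤ c • ω}.Nonempty := by
    intro y
    obtain ⟨c, hc⟩ := y.2
    exact ⟨c, (le_abs_self _).trans hc⟩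
  have hbd : ∀ y : I, BddBelow {c : ℝ | (y : G) ≤ c • ω} := by
    intro y
    obtain ⟨c, hc⟩ := y.2
    refine ⟨-c, fun d hd => ?_⟩
    have h1 : 0 ≤ (d + c) • ω := by
      rw [add_smul]
      have h2 : -(y : G) ≤ c • ω := (neg_le_abs _).trans hc
      have := add_le_add hd h2
      rwa [add_neg_cancel] at this
    linarith [hωpos _ h1]
  have hle : ∀ y : I, ∀ c : ℝ, (y : G) ≤ c • ω → q y ≤ c := fun y c hc => csInf_le (hbd y) hc
  have hge : ∀ y : I, ∀ c : ℝ, q y < c → (y : G) ≤ c • ω := by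
    intro y c hc
    obtain ⟨d, hd, hdc⟩ := exists_lt_of_csInf_lt (hne y) hc
    exact le_trans hd (hmono d c hdc.le)
  let j : I → I → I := fun y z => ⟨y ⊔ z, sup_mem_principalIdeal y.2 z.2⟩
  have hqm : IsMaxSublinear j q := by
    refine ⟨fun y z => ?_, fun t ht y => ?_, fun y z => ?_⟩
    · refine le_of_forall_pos_le_add fun ε hε => ?_
      have h1 := hge y (q y + ε / 2) (by linarith)
      have h2 := hge z (q z + ε / 2) (by linarith)
      refine hle _ _ ?_
      have := add_le_add h1 h2
      rw [← add_smul] at this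
      refine this.trans (hmono _ _ (by linarith))
    · refine le_of_forall_pos_le_add fun ε hε => ?_
      have h1 := hge y (q y + ε / t) (lt_add_of_pos_right _ (by positivity))
      refine hle _ _ ?_
      have := smul_le_smul_of_nonneg_left h1 ht.le
      rw [smul_smul] at this
      refine this.trans (hmono _ _ (le_of_eq ?_))
      field_simp
    · refine le_antisymm ?_ (max_le ?_ ?_)
      · refine le_of_forall_pos_le_add fun ε hε => ?_
        refine hle _ _ (sup_le ?_ ?_)
        · exact hge _ _ (by linarith [le_max_left (q y) (q z)])
        · exact hge _ _ (by linarith [le_max_right (q y) (q z)])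
      · refine le_of_forall_pos_le_add fun ε hε => hle _ _ ?_
        exact le_trans le_sup_left (hge (j y z) (q (j y z) + ε) (by linarith))
      · refine le_of_forall_pos_le_add fun ε hε => hle _ _ ?_
        exact le_trans le_sup_right (hge (j y z) (q (j y z) + ε) (by linarith))
  have hj : ∀ x y z, j x y + z = j (x + z) (y + z) := by
    intro x y z
    exact Subtype.ext (sup_add _ _ _)
  -- A homomorphism with `φ x = q x` exists, so the hypothesis on characters gives `q x ≤ 0`, and
  -- the Archimedean property concludes.
  obtain ⟨φ, hφq, hφx, hφj⟩ := hqm.exists_linear hj ⟨x, hx⟩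
  have hωI : ω ∈ I := ⟨1, by rw [one_smul, abs_of_nonneg hω]⟩
  have hφω : φ ⟨ω, hωI⟩ = 1 := by
    refine le_antisymm ((hφq _).trans (hle _ _ (by simp))) ?_
    have := (hφq (-⟨ω, hωI⟩)).trans (hle _ (-1) (by simp))
    rw [map_neg] at this
    linarith
  -- A character is constrained only on the ideal, so any linear extension to `G` will do.
  obtain ⟨ψ, hψ⟩ := LinearMap.exists_extend φ
  have hψI : ∀ y (hy : y ∈ I), ψ y = φ ⟨y, hy⟩ := fun y hy => LinearMap.congr_fun hψ ⟨y, hy⟩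
  have hchar : IsCharacter ω ψ := by
    refine ⟨by rw [hψI _ hωI, hφω], fun y hy z hz => ?_⟩
    rw [hψI _ hy, hψI _ hz, hψI _ (sup_mem_principalIdeal hy hz)]
    exact hφj ⟨y, hy⟩ ⟨z, hz⟩
  have h1 := h ψ hchar
  rw [hψI _ hx, hφx] at h1
  exact hx0 (harch x fun ε hε => hge ⟨x, hx⟩ ε (by linarith))

theorem le_of_forall_isCharacter {ω : G} (hω : 0 ≤ ω)
    (harch : ∀ x : G, (∀ ε : ℝ, 0 < ε → x ≤ ε • ω) → x ≤ 0) {x y : G}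
    (hx : x ∈ principalIdeal ω) (hy : y ∈ principalIdeal ω)
    (h : ∀ φ, IsCharacter ω φ → φ x ≤ φ y) : x ≤ y := by
  refine sub_nonpos.1 (le_zero_of_forall_isCharacter hω harch (sub_mem hx hy) fun φ hφ => ?_)
  rw [map_sub]
  linarith [h φ hφ]

theorem self_mem_principalIdeal {ω : G} (hω : 0 ≤ ω) : ω ∈ principalIdeal ω :=
  ⟨1, by rw [one_smul, abs_of_nonneg hω]⟩

end Characters
-- Finite partitions of an order unit.
section Partition

variable {G : Type u} [AddCommGroup G] [Module ℝ G] [Lattice G] [IsOrderedAddMonoid G]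
  [IsOrderedModule ℝ G]

theorem IsCharacter.abs_apply_le {ω : G} {φ : G →ₗ[ℝ] ℝ} (hω : 0 ≤ ω) (hφ : IsCharacter ω φ)
    {x : G} {c : ℝ} (hx : |x| ≤ c • ω) : |φ x| ≤ c := by
  have hxI : x ∈ principalIdeal ω := ⟨c, hx⟩
  have := hφ.mono (abs_mem_principalIdeal hxI)
    (Submodule.smul_mem _ c (self_mem_principalIdeal hω)) hx
  rwa [hφ.map_abs hxI, map_smul, hφ.map_unit, smul_eq_mul, mul_one] at this

/-- Finitely many characters suffice to approximate all the others on finitely many vectors. -/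
theorem exists_finite_characters {ω : G} (hω : 0 ≤ ω) {ι : Type v} [Fintype ι] (ζ : ι → G)
    (hζ : ∀ r, ζ r ∈ principalIdeal ω) {ε : ℝ} (hε : 0 < ε) :
    ∃ (n : ℕ) (φ : Fin n → G →ₗ[ℝ] ℝ), (∀ j, IsCharacter ω (φ j)) ∧
      ∀ ψ, IsCharacter ω ψ → ∃ j, ∀ r, |ψ (ζ r) - φ j (ζ r)| ≤ ε := by
  choose c hc using hζ
  set A : Set (ι → ℝ) := {v | ∃ φ, IsCharacter ω φ ∧ v = fun r => φ (ζ r)} with hA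
  -- The values of all characters on the `ζ r` form a bounded set in a finite-dimensional space.
  -- Total boundedness of this set replaces compactness of the space of characters.
  have hAb : Bornology.IsBounded A := by
    refine (Metric.isBounded_Icc (fun r => -c r) c).subset ?_
    rintro _ ⟨φ, hφ, rfl⟩
    exact ⟨fun r => (abs_le.1 (hφ.abs_apply_le hω (hc r))).1,
      fun r => (abs_le.1 (hφ.abs_apply_le hω (hc r))).2⟩
  have htb : TotallyBounded A := (hAb.isCompact_closure.totallyBounded).subset subset_closure
  obtain ⟨t, htA, htf, htc⟩ := Metric.finite_approx_of_totallyBounded htb _ hε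
  have := htf.fintype
  let f := (Fintype.equivFin t).symm
  have h1 : ∀ j, ∃ φ, IsCharacter ω φ ∧ (f j : ι → ℝ) = fun r => φ (ζ r) := fun j => htA (f j).2
  choose φ hφ hφf using h1
  refine ⟨_, φ, hφ, fun ψ hψ => ?_⟩
  have h2 := htc ⟨ψ, hψ, rfl⟩
  simp only [Set.mem_iUnion, Metric.mem_ball] at h2
  obtain ⟨v, hv, hd⟩ := h2
  refine ⟨f.symm ⟨v, hv⟩, fun r => ?_⟩
  have h3 := congrFun (hφf (f.symm ⟨v, hv⟩)) r
  rw [Equiv.apply_symm_apply] at h3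
  rw [← h3, ← Real.dist_eq]
  exact (dist_le_pi_dist _ _ r).trans hd.le

/-- A partition of `ω` on the pieces of which finitely many given vectors are almost constant. -/
theorem exists_partition {ω : G} (hω : 0 ≤ ω)
    (harch : ∀ x : G, (∀ ε : ℝ, 0 < ε → x ≤ ε • ω) → x ≤ 0) {ι : Type v} [Fintype ι] (ζ : ι → G)
    (hζ : ∀ r, ζ r ∈ principalIdeal ω) {ε : ℝ} (hε : 0 < ε) :
    ∃ (n : ℕ) (e : Fin n → G) (φ : Fin n → G →ₗ[ℝ] ℝ), (∀ j, 0 ≤ e j) ∧ ∑ j, e j = ω ∧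
      (∀ j, IsCharacter ω (φ j)) ∧ ∀ r, |ζ r - ∑ j, φ j (ζ r) • e j| ≤ ε • ω := by
  set N : ℝ := (Fintype.card ι : ℝ) with hN
  have hN0 : 0 ≤ N := by positivity
  -- With this radius the errors of all `N` vectors add up to at most `ε / 2`.
  obtain ⟨n, φ, hφ, hdense⟩ := exists_finite_characters hω ζ hζ
    (show 0 < ε / (2 * (N + 1)) by positivity)
  have hωI := self_mem_principalIdeal hω
  set I := principalIdeal ω with hI
  set d : Fin n → G := fun j => ∑ r, |ζ r - φ j (ζ r) • ω| with hd
  have hdI : ∀ j, d j ∈ I := fun j => sum_mem fun r _ =>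
    abs_mem_principalIdeal (sub_mem (hζ r) (Submodule.smul_mem _ _ hωI))
  have hψd : ∀ ψ, IsCharacter ω ψ → ∀ j, ψ (d j) = ∑ r, |ψ (ζ r) - φ j (ζ r)| := by
    intro ψ hψ j
    simp only [hd]
    rw [map_sum]
    refine Finset.sum_congr rfl fun r _ => ?_
    rw [hψ.map_abs (sub_mem (hζ r) (Submodule.smul_mem _ _ hωI)), map_sub, map_smul, hψ.map_unit,
      smul_eq_mul, mul_one]
  -- A bump at `φ j`: a character `ψ` is positive on it only if `ψ (d j) < ε`. The value `0` from
  -- `n` on allows sums over ranges of natural numbers.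
  set m : ℕ → G := fun i => if h : i < n then (ε • ω - d ⟨i, h⟩) ⊔ 0 else 0 with hm
  have hm0 : ∀ i, 0 ≤ m i := by
    intro i
    simp only [hm]
    split_ifs
    · exact le_sup_right
    · exact le_rfl
  have hmI : ∀ i, m i ∈ I := by
    intro i
    simp only [hm]
    split_ifs
    · exact sup_mem_principalIdeal (sub_mem (Submodule.smul_mem _ _ hωI) (hdI _)) (zero_mem _)
    · exact zero_mem _
  have hψm : ∀ ψ, IsCharacter ω ψ → ∀ j : Fin n, ψ (m j) = max (ε - ψ (d j)) 0 := by
    intro ψ hψ j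
    simp only [hm, j.2, dif_pos, Fin.eta]
    rw [hψ.map_sup _ (sub_mem (Submodule.smul_mem _ _ hωI) (hdI _)) _ (zero_mem _), map_sub,
      map_smul, hψ.map_unit, smul_eq_mul, mul_one, map_zero]
  -- Each character lies near some `φ j` and takes a value of at least `ε / 2` on `m j`, so the
  -- factor `2 / ε` lifts the full sum above `ω`.
  set s : ℕ → G := fun i => (2 / ε) • ∑ k ∈ Finset.range i, m k with hs
  have hsI : ∀ i, s i ∈ I := fun i => Submodule.smul_mem _ _ (sum_mem fun k _ => hmI k)
  have hs_succ : ∀ i, s (i + 1) = s i + (2 / ε) • m i := by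
    intro i
    simp only [hs]
    rw [Finset.sum_range_succ, smul_add]
  have hs_mono : ∀ i, s i ≤ s (i + 1) := by
    intro i
    rw [hs_succ]
    exact le_add_of_nonneg_right (smul_nonneg (by positivity) (hm0 i))
  -- The increments of `ω ⊓ s i` are positive and telescope from `0` to `ω`.
  set e : Fin n → G := fun j => ω ⊓ s (j + 1) - ω ⊓ s j with he
  have heI : ∀ j, e j ∈ I := fun j => sub_mem (inf_mem_principalIdeal hωI (hsI _))
    (inf_mem_principalIdeal hωI (hsI _))
  have he0 : ∀ j, 0 ≤ e j := fun j => sub_nonneg.2 (inf_le_inf_left _ (hs_mono _))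
  have hsn : ω ≤ s n := by
    refine le_of_forall_isCharacter hω harch hωI (hsI n) fun ψ hψ => ?_
    obtain ⟨j, hj⟩ := hdense ψ hψ
    have h1 : ψ (d j) ≤ ε / 2 := by
      rw [hψd ψ hψ]
      refine (Finset.sum_le_card_nsmul _ _ _ fun r _ => hj r).trans ?_
      rw [Finset.card_univ, nsmul_eq_mul, ← hN, mul_div_assoc', div_le_div_iff₀ (by positivity)
        (by positivity)]
      nlinarith
    have h2 : ψ (m j) ≤ ψ (∑ k ∈ Finset.range n, m k) := by
      rw [map_sum]
      exact Finset.single_le_sum (f := fun k => ψ (m k)) (fun k _ => hψ.nonneg (hmI k) (hm0 k))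
        (Finset.mem_range.2 j.2)
    rw [hψm ψ hψ] at h2
    have h3 := (le_max_left (ε - ψ (d j)) 0).trans h2
    simp only [hs]
    rw [map_smul, hψ.map_unit, smul_eq_mul]
    calc (1 : ℝ) = 2 / ε * (ε / 2) := by field_simp
      _ ≤ _ := by gcongr; linarith
  have hsum : ∑ j, e j = ω := by
    have h1 := Finset.sum_range (n := n) fun i => ω ⊓ s (i + 1) - ω ⊓ s i
    rw [Finset.sum_range_sub (fun i => ω ⊓ s i)] at h1
    simp only [he]
    rw [← h1, inf_eq_left.2 hsn]
    simp [hs, hω]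
  -- If `ψ` is far from `φ j` at one `ζ r`, then `ψ (m j) = 0`, so `ψ (s (j + 1)) = ψ (s j)` and the
  -- increment vanishes.
  have hsupp : ∀ ψ, IsCharacter ω ψ → ∀ j, ψ (e j) ≠ 0 → ∀ r, |ψ (ζ r) - φ j (ζ r)| ≤ ε := by
    intro ψ hψ j hne r
    by_contra hlt
    push Not at hlt
    refine hne ?_
    have h1 : ε ≤ ψ (d j) := by
      rw [hψd ψ hψ]
      exact hlt.le.trans (Finset.single_le_sum (f := fun r => |ψ (ζ r) - φ j (ζ r)|)
        (fun _ _ => abs_nonneg _) (Finset.mem_univ r))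
    have h2 : ψ (m j) = 0 := by
      rw [hψm ψ hψ]
      exact max_eq_right (by linarith)
    simp only [he]
    rw [map_sub, hψ.map_inf hωI (hsI _), hψ.map_inf hωI (hsI _), hs_succ, map_add, map_smul _ _ (m j), h2]
    simp
  refine ⟨n, e, φ, he0, hsum, hφ, fun r => ?_⟩
  have hxI : ζ r - ∑ j, φ j (ζ r) • e j ∈ I :=
    sub_mem (hζ r) (sum_mem fun j _ => Submodule.smul_mem _ _ (heI j))
  refine le_of_forall_isCharacter hω harch (abs_mem_principalIdeal hxI)
    (Submodule.smul_mem _ _ hωI) fun ψ hψ => ?_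
  have hone : ∑ j, ψ (e j) = 1 := by rw [← map_sum, hsum, hψ.map_unit]
  rw [hψ.map_abs hxI, map_smul, hψ.map_unit, smul_eq_mul, mul_one, map_sub, map_sum]
  have h1 : ψ (ζ r) - ∑ j, ψ (φ j (ζ r) • e j) = ∑ j, (ψ (ζ r) - φ j (ζ r)) * ψ (e j) := by
    simp only [map_smul, smul_eq_mul, sub_mul]
    rw [Finset.sum_sub_distrib, ← Finset.mul_sum, hone, mul_one]
  rw [h1]
  calc |∑ j, (ψ (ζ r) - φ j (ζ r)) * ψ (e j)|
      ≤ ∑ j, |(ψ (ζ r) - φ j (ζ r)) * ψ (e j)| := Finset.abs_sum_le_sum_abs _ _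
    _ ≤ ∑ j, ε * ψ (e j) := by
        refine Finset.sum_le_sum fun j _ => ?_
        have h0 := hψ.nonneg (heI j) (he0 j)
        rw [abs_mul, abs_of_nonneg h0]
        by_cases hz : ψ (e j) = 0
        · rw [hz, mul_zero, mul_zero]
        · exact mul_le_mul_of_nonneg_right (hsupp ψ hψ j hz r) h0
    _ = ε := by rw [← Finset.mul_sum, hone, mul_one]

end Partition

/-! ### The Archimedean property, Riesz–Kantorovich, and finite nets. -/

/-- Banach lattices are Archimedean. -/
theorem le_zero_of_forall_le_smul {E : Type u} [NormedAddCommGroup E] [NormedSpace ℝ E]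
    [Lattice E] [IsOrderedAddMonoid E] [HasSolidNorm E] {ω x : E}
    (h : ∀ ε : ℝ, 0 < ε → x ≤ ε • ω) : x ≤ 0 := by
  have h1 : Filter.Tendsto (fun ε : ℝ => ε • ω) (nhdsWithin 0 (Set.Ioi 0)) (nhds ((0 : ℝ) • ω)) :=
    ((continuous_id.smul continuous_const).tendsto 0).mono_left nhdsWithin_le_nhds
  rw [zero_smul] at h1
  exact ge_of_tendsto h1 (by filter_upwards [self_mem_nhdsWithin] with ε hε using h ε hε)

/-- The Riesz–Kantorovich formula for the supremum of finitely many functionals. -/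
theorem DualLattice.exists_sum_of_sup' {E : Type u} [NormedAddCommGroup E] [NormedSpace ℝ E]
    [Lattice E] [IsOrderedAddMonoid E] [HasSolidNorm E] [IsOrderedModule ℝ E] {ι : Type v}
    {s : Finset ι} (hs : s.Nonempty) (f : ι → DualLattice E) :
    ∀ x : E, 0 ≤ x → ∀ ε : ℝ, 0 < ε → ∃ d : ι → E, (∀ i, 0 ≤ d i) ∧ ∑ i ∈ s, d i = x ∧
      s.sup' hs f x ≤ ∑ i ∈ s, f i (d i) + ε := by
  classical
  induction hs using Finset.Nonempty.cons_induction with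
  | singleton a =>
    intro x hx ε hε
    exact ⟨fun _ => x, fun _ => hx, by simp, by simpa using hε.le⟩
  | cons a s ha hs ih =>
    intro x hx ε hε
    set g := s.sup' hs f with hg
    have e1 : (Finset.cons a s ha).sup' (Finset.cons_nonempty ha) f = f a ⊔ g :=
      Finset.sup'_cons hs f
    have e2 : (f a ⊔ g) x = g x + posVal (f a - g) x := by
      rw [← pos_apply _ hx]; rfl
    -- Half of the error goes into a nearly optimal `y` for the supremum that defines the positive
    -- part of `f a - g`; the other half goes into splitting `x - y` among the remaining
    -- functionals.
    obtain ⟨_, ⟨y, hy, rfl⟩, hlt⟩ := exists_lt_of_lt_csSup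
      (s := (f a - g) '' Set.Icc 0 x) ⟨_, 0, ⟨le_rfl, hx⟩, rfl⟩
      (show posVal (f a - g) x - ε / 2 < posVal (f a - g) x by linarith)
    obtain ⟨d, hd0, hdsum, hdle⟩ := ih (x - y) (sub_nonneg.2 hy.2) (ε / 2) (by linarith)
    have hne : ∀ i ∈ s, i ≠ a := fun i hi h => ha (h ▸ hi)
    refine ⟨fun i => if i = a then y else d i, fun i => ?_, ?_, ?_⟩
    · dsimp only
      split_ifs
      · exact hy.1
      · exact hd0 i
    · rw [Finset.sum_cons, if_pos rfl, Finset.sum_congr rfl fun i hi => if_neg (hne i hi), hdsum]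
      abel
    · simp only
      rw [Finset.sum_cons, if_pos rfl, e1, e2,
        Finset.sum_congr rfl fun i hi => by rw [if_neg (hne i hi)]]
      rw [sub_apply] at hlt
      rw [map_sub] at hdle
      linarith

section Net

variable {E : Type u} [NormedAddCommGroup E] [NormedSpace ℝ E] [Lattice E] [IsOrderedAddMonoid E]
  [HasSolidNorm E] [IsOrderedModule ℝ E] [CompleteSpace E]

/-- Linear combinations with coefficients in a bounded set are dominated, up to `ε`, by finitely
many of them. -/
theorem exists_finset_linearComb_le {n : ℕ} {A : Set (Fin n → ℝ)} (hb : Bornology.IsBounded A)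
    (x : Fin n → E) {ε : ℝ} (hε : 0 < ε) :
    ∃ t : Finset (Fin n → ℝ), (∀ a ∈ t, a ∈ A) ∧
      ∀ a ∈ A, ∃ b ∈ t, ∑ i, a i • x i ≤ ∑ i, b i • x i + ε • ∑ i, |x i| := by
  have htb : TotallyBounded A := (hb.isCompact_closure.totallyBounded).subset subset_closure
  obtain ⟨t, htA, htf, htc⟩ := Metric.finite_approx_of_totallyBounded htb _ hε
  refine ⟨htf.toFinset, fun a ha => htA (by simpa using ha), fun a ha => ?_⟩
  have h := htc ha
  simp only [Set.mem_iUnion, Metric.mem_ball] at h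
  obtain ⟨b, hbt, hd⟩ := h
  refine ⟨b, by simpa using hbt, ?_⟩
  rw [← sub_le_iff_le_add', ← Finset.sum_sub_distrib, Finset.smul_sum]
  refine Finset.sum_le_sum fun i _ => ?_
  rw [← sub_smul]
  refine (smul_le_abs_smul_abs _ _).trans (smul_le_smul_of_nonneg_right ?_ (abs_nonneg _))
  rw [← Real.dist_eq]
  exact (dist_le_pi_dist a b i).trans hd.le

end Net
theorem DualLattice.sum_apply {E : Type u} [NormedAddCommGroup E] [NormedSpace ℝ E]
    {ι : Type v} (s : Finset ι) (f : ι → DualLattice E) (x : E) :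
    (∑ i ∈ s, f i) x = ∑ i ∈ s, f i x := by
  classical
  induction s using Finset.induction_on with
  | empty => simp [zero_apply]
  | insert a s ha ih => rw [Finset.sum_insert ha, Finset.sum_insert ha, add_apply, ih]

theorem abs_sum_le {G : Type u} [AddCommGroup G] [Lattice G] [IsOrderedAddMonoid G] {ι : Type v}
    (s : Finset ι) (f : ι → G) : |∑ i ∈ s, f i| ≤ ∑ i ∈ s, |f i| :=
  Finset.le_sum_of_subadditive _ abs_zero.le abs_add_le s f

/-! ### Finite-dimensional `ℓ_p`: Hölder, weights, polarity. -/

section FiniteLp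

variable {n : ℕ} {p : ℝ≥0∞}

theorem holderConjugate_conjExponent (hp : 1 ≤ p) : ENNReal.HolderConjugate p p.conjExponent :=
  .conjExponent hp

theorem norm_toLp_mono (hp : 1 ≤ p) {a b : Fin n → ℝ} (h : ∀ i, |a i| ≤ |b i|) :
    ‖WithLp.toLp p a‖ ≤ ‖WithLp.toLp p b‖ := by
  rcases eq_or_ne p ∞ with rfl | hp'
  · rw [PiLp.norm_toLp, PiLp.norm_toLp, pi_norm_le_iff_of_nonneg (norm_nonneg _)]
    exact fun i => (h i).trans (norm_le_pi_norm b i)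
  · have h0 : 0 < p.toReal := ENNReal.toReal_pos (zero_lt_one.trans_le hp).ne' hp'
    rw [PiLp.norm_eq_sum h0, PiLp.norm_eq_sum h0]
    refine Real.rpow_le_rpow (Finset.sum_nonneg fun i _ => by positivity) ?_ (by positivity)
    exact Finset.sum_le_sum fun i _ => Real.rpow_le_rpow (norm_nonneg _) (h i) h0.le

/-- Hölder's inequality in `ℓ_p^n`. -/
theorem sum_mul_le_norm_mul_norm (hp : 1 ≤ p) (a b : Fin n → ℝ) :
    ∑ i, a i * b i ≤ ‖WithLp.toLp p a‖ * ‖WithLp.toLp p.conjExponent b‖ := by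
  have key : ∀ c d : Fin n → ℝ, ∑ i, c i * d i ≤
      ‖WithLp.toLp 1 c‖ * ‖WithLp.toLp ∞ d‖ := by
    intro c d
    rw [PiLp.norm_eq_of_L1, PiLp.norm_toLp, Finset.sum_mul]
    refine Finset.sum_le_sum fun i _ => ?_
    refine (le_abs_self _).trans ?_
    rw [abs_mul]
    exact mul_le_mul_of_nonneg_left (norm_le_pi_norm d i) (abs_nonneg _)
  rcases hp.eq_or_lt with rfl | h1
  · have : ENNReal.conjExponent 1 = ∞ := by simp [ENNReal.conjExponent]
    rw [this]
    exact key a b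
  rcases eq_or_ne p ∞ with rfl | hp'
  · have : ENNReal.conjExponent ∞ = 1 := by simp [ENNReal.conjExponent]
    rw [this, mul_comm]
    simpa only [mul_comm] using key b a
  have hc := holderConjugate_conjExponent hp
  have hq1 : p.conjExponent ≠ ∞ := by
    simp only [ENNReal.conjExponent, ne_eq, ENNReal.add_eq_top, ENNReal.one_ne_top, false_or,
      ENNReal.inv_eq_top]
    exact (tsub_pos_of_lt h1).ne'
  have h0 : 0 < p.toReal := ENNReal.toReal_pos (zero_lt_one.trans h1).ne' hp'
  have h0' : 0 < p.conjExponent.toReal :=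
    ENNReal.toReal_pos (zero_lt_one.trans_le (one_le_conjExponent p)).ne' hq1
  have hr : p.toReal.HolderConjugate p.conjExponent.toReal := by
    simpa using ENNReal.HolderTriple.toReal 1 h0 h0'
  rw [PiLp.norm_eq_sum h0, PiLp.norm_eq_sum h0']
  exact Real.inner_le_Lp_mul_Lq Finset.univ a b hr

/-- The `p`-th powers of the weights sum to `1`. For `p = ∞`, `toReal` is `0`, so every weight is
`1`, also where `a i = 0`, and the maximum is still at most `1`. -/
theorem norm_toLp_weights_le_one (hp : 1 ≤ p) {a : Fin n → ℝ} (h0 : ∀ i, 0 ≤ a i)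
    (h1 : ∑ i, a i = 1) : ‖WithLp.toLp p fun i => a i ^ (1 / p.toReal)‖ ≤ 1 := by
  rcases eq_or_ne p ∞ with rfl | hp'
  · rw [PiLp.norm_toLp, pi_norm_le_iff_of_nonneg zero_le_one]
    intro i
    simp
  · have hp0 : 0 < p.toReal := ENNReal.toReal_pos (zero_lt_one.trans_le hp).ne' hp'
    rw [PiLp.norm_eq_sum hp0]
    refine Real.rpow_le_one (Finset.sum_nonneg fun i _ => by positivity) (le_of_eq ?_)
      (by positivity)
    refine (Finset.sum_congr rfl fun i _ => ?_).trans h1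
    change ‖a i ^ (1 / p.toReal)‖ ^ p.toReal = a i
    rw [Real.norm_of_nonneg (Real.rpow_nonneg (h0 i) _), ← Real.rpow_mul (h0 i),
      one_div_mul_cancel hp0.ne', Real.rpow_one]

/-- The exponents sum to `1`, the endpoints included. A nonzero sum is what makes the power law
valid at `a = 0`. -/
theorem weight_mul_weight (hp : 1 ≤ p) {a : ℝ} (h0 : 0 ≤ a) :
    a ^ (1 / p.toReal) * a ^ (1 / p.conjExponent.toReal) = a := by
  have h := (holderConjugate_conjExponent hp).inv_add_inv_eq_inv
  have h2 := congrArg ENNReal.toReal h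
  have hq := one_le_conjExponent p
  rw [ENNReal.toReal_add (by simpa using (zero_lt_one.trans_le hp).ne')
    (by simpa using (zero_lt_one.trans_le hq).ne'), ENNReal.toReal_inv, ENNReal.toReal_inv] at h2
  simp only [inv_one, ENNReal.toReal_one] at h2
  rw [← Real.rpow_add' h0 (by rw [one_div, one_div, h2]; exact one_ne_zero), one_div, one_div, h2,
    Real.rpow_one]

/-- The polar of the unit ball of `ℓ_q^n`, where `q` is conjugate to `p`. -/
def polarBall (p : ℝ≥0∞) (n : ℕ) : Set (Fin n → ℝ) :=
  {b | ∀ a ∈ conjBall p n, ∑ i, a i * b i ≤ 1}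

theorem zero_mem_conjBall : (0 : Fin n → ℝ) ∈ conjBall p n := by
  have : Fact (1 ≤ p.conjExponent) := ⟨one_le_conjExponent p⟩
  simp [conjBall]

theorem zero_mem_polarBall : (0 : Fin n → ℝ) ∈ polarBall p n := fun a _ => by simp

theorem mem_conjBall_of_abs_le {a b : Fin n → ℝ} (ha : a ∈ conjBall p n)
    (h : ∀ i, |b i| ≤ |a i|) : b ∈ conjBall p n :=
  (norm_toLp_mono (one_le_conjExponent p) h).trans ha

/-- The ball is invariant under sign changes, so `b` may be tested against `|a|` with the signs of
`b`. -/
theorem sum_abs_mul_abs_le_one {a b : Fin n → ℝ} (ha : a ∈ conjBall p n)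
    (hb : b ∈ polarBall p n) : ∑ i, |a i| * |b i| ≤ 1 := by
  have h := hb (fun i => |a i| * SignType.sign (b i)) (mem_conjBall_of_abs_le ha fun i => by
    rw [abs_mul, abs_abs]
    refine mul_le_of_le_one_right (abs_nonneg _) ?_
    rcases lt_trichotomy (b i) 0 with h | h | h <;> simp [h])
  refine le_trans (le_of_eq (Finset.sum_congr rfl fun i _ => ?_)) h
  rw [mul_assoc, sign_mul_self]

theorem abs_le_of_mem_polarBall {b : Fin n → ℝ} (hb : b ∈ polarBall p n) (i : Fin n) :
    |b i| ≤ 1 := by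
  have : Fact (1 ≤ p.conjExponent) := ⟨one_le_conjExponent p⟩
  have h1 : (Pi.single i 1 : Fin n → ℝ) ∈ conjBall p n := by
    change ‖WithLp.toLp p.conjExponent (Pi.single i 1 : Fin n → ℝ)‖ ≤ 1
    exact (PiLp.norm_single p.conjExponent (fun _ : Fin n => ℝ) i 1).trans norm_one |>.le
  have h := sum_abs_mul_abs_le_one h1 hb
  rw [Finset.sum_eq_single i (fun j _ hj => by simp [hj]) (by simp)] at h
  simpa using h

theorem isBounded_polarBall : Bornology.IsBounded (polarBall p n) := by
  refine (Metric.isBounded_closedBall (x := (0 : Fin n → ℝ)) (r := 1)).subset fun b hb => ?_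
  rw [mem_closedBall_zero_iff, pi_norm_le_iff_of_nonneg zero_le_one]
  exact fun i => abs_le_of_mem_polarBall hb i

theorem convex_conjBall : Convex ℝ (conjBall p n) := by
  have : Fact (1 ≤ p.conjExponent) := ⟨one_le_conjExponent p⟩
  intro a ha b hb s t hs ht hst
  change ‖WithLp.toLp p.conjExponent (s • a + t • b)‖ ≤ 1
  rw [WithLp.toLp_add, WithLp.toLp_smul, WithLp.toLp_smul]
  refine (norm_add_le _ _).trans ?_
  rw [norm_smul, norm_smul, Real.norm_of_nonneg hs, Real.norm_of_nonneg ht]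
  calc s * _ + t * _ ≤ s * 1 + t * 1 := by gcongr <;> assumption
    _ = 1 := by linarith

theorem isClosed_conjBall : IsClosed (conjBall p n) := by
  have : Fact (1 ≤ p.conjExponent) := ⟨one_le_conjExponent p⟩
  exact isClosed_le ((PiLp.continuous_toLp p.conjExponent _).norm) continuous_const

/-- The bipolar theorem for the unit ball of `ℓ_q^n`. -/
theorem mem_conjBall_of_forall_polarBall {g : Fin n → ℝ}
    (h : ∀ b ∈ polarBall p n, ∑ i, g i * b i ≤ 1) : g ∈ conjBall p n := by
  by_contra hg
  -- A functional separating `g` from the ball, divided by its level `s > 0`, gives a point of the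
  -- polar whose pairing with `g` exceeds `1`.
  obtain ⟨f, s, hfs, hs⟩ := geometric_hahn_banach_closed_point convex_conjBall isClosed_conjBall hg
  have hs0 : 0 < s := by simpa using hfs 0 zero_mem_conjBall
  have hf : ∀ a : Fin n → ℝ, f a = ∑ i, a i * f (Pi.single i 1) := by
    intro a
    conv_lhs => rw [pi_eq_sum_univ' a]
    simp [map_sum]
  have hb : (fun i => s⁻¹ * f (Pi.single i 1)) ∈ polarBall p n := by
    intro a ha
    have h1 := (hfs a ha).le
    rw [hf] at h1
    calc ∑ i, a i * (s⁻¹ * f (Pi.single i 1)) = s⁻¹ * ∑ i, a i * f (Pi.single i 1) := by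
          rw [Finset.mul_sum]; exact Finset.sum_congr rfl fun i _ => by ring
      _ ≤ s⁻¹ * s := by gcongr
      _ = 1 := inv_mul_cancel₀ hs0.ne'
  have h2 := h _ hb
  rw [hf] at hs
  have h3 : ∑ i, g i * (s⁻¹ * f (Pi.single i 1)) = s⁻¹ * ∑ i, g i * f (Pi.single i 1) := by
    rw [Finset.mul_sum]; exact Finset.sum_congr rfl fun i _ => by ring
  rw [h3] at h2
  have h4 := mul_lt_mul_of_pos_left hs (inv_pos.2 hs0)
  rw [inv_mul_cancel₀ hs0.ne'] at h4
  linarith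

end FiniteLp

/-! ### Convexity of the dual of a `p`-concave lattice. -/

section Concave

variable {L : Type u} [NormedAddCommGroup L] [NormedSpace ℝ L] [Lattice L] [IsOrderedAddMonoid L]
  [HasSolidNorm L] [IsOrderedModule ℝ L] [CompleteSpace L]

theorem lpSum_nonneg (p : ℝ≥0∞) {n : ℕ} (x : Fin n → L) : 0 ≤ lpSum p x := by
  have := (isLUB_lpSum p x).1 ⟨0, zero_mem_conjBall, rfl⟩
  simpa using this

/-- The dual of a `p`-concave Banach lattice is `p'`-convex, where the `p'`-sum is replaced by an
almost optimal upper bound. -/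
theorem IsPConcave.exists_dual_bound {p : ℝ≥0∞} (hp : 1 ≤ p) (hL : IsPConcave p L) {n : ℕ}
    (ξ : Fin n → DualLattice L) (ν : Fin n → ℝ) (hξ : ∀ k, ‖ξ k‖ ≤ ν k)
    (hν : ν ∈ conjBall p n) {δ : ℝ} (hδ : 0 < δ) :
    ∃ H : DualLattice L, ‖H‖ ≤ 1 + δ ∧ ∀ b ∈ polarBall p n, ∑ k, b k • ξ k ≤ H := by
  classical
  set W : DualLattice L := ∑ k, |ξ k| with hW
  -- This choice keeps the norm of the net error, a multiple of `W`, below `δ`.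
  have hε : 0 < δ / (‖W‖ + 1) := by positivity
  obtain ⟨t₀, ht₀, hnet⟩ := exists_finset_linearComb_le (isBounded_polarBall (p := p)) ξ hε
  -- Including `0` makes the net nonempty and its supremum `H` positive.
  set t := insert 0 t₀ with ht
  have htne : t.Nonempty := Finset.insert_nonempty _ _
  have htp : ∀ b ∈ t, b ∈ polarBall p n := by
    intro b hb
    rcases Finset.mem_insert.1 hb with rfl | hb
    · exact zero_mem_polarBall
    · exact ht₀ b hb
  set H := t.sup' htne fun b => ∑ k, b k • ξ k with hH
  have hH0 : 0 ≤ H := by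
    have := Finset.le_sup' (fun b : Fin n → ℝ => ∑ k, b k • ξ k) (Finset.mem_insert_self 0 t₀)
    simpa using this
  have hHy : ∀ y : L, 0 ≤ y → H y ≤ ‖y‖ := by
    intro y hy
    refine le_of_forall_pos_le_add fun ε hε => ?_
    obtain ⟨d, hd0, hdsum, hdle⟩ := DualLattice.exists_sum_of_sup' htne
      (fun b : Fin n → ℝ => ∑ k, b k • ξ k) y hy ε hε
    refine hdle.trans (add_le_add_left ?_ ε)
    -- Riesz–Kantorovich splits `y` into pieces `d b`. Collecting the terms by `k` leaves `∑ ξ k (V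
    -- k)`, to which Hölder applies once the `p`-sum of the `V k` is controlled.
    set V : Fin n → L := fun k => ∑ b ∈ t, b k • d b with hV
    have h1 : ∑ b ∈ t, (∑ k, b k • ξ k) (d b) = ∑ k, ξ k (V k) := by
      have h2 : ∀ b : Fin n → ℝ, ∀ x : L, (∑ k, b k • ξ k) x = ∑ k, b k * ξ k x := by
        intro b x
        rw [DualLattice.sum_apply]
        rfl
      simp only [h2, hV]
      rw [Finset.sum_comm]
      refine Finset.sum_congr rfl fun k _ => ?_
      rw [map_sum]
      exact Finset.sum_congr rfl fun b _ => by rw [map_smul, smul_eq_mul]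
    have habs : ∀ k, |V k| ≤ ∑ b ∈ t, |b k| • d b := by
      intro k
      refine (abs_sum_le _ _).trans (Finset.sum_le_sum fun b _ => ?_)
      refine abs_le'.2 ⟨smul_le_smul_of_nonneg_right (le_abs_self _) (hd0 b), ?_⟩
      rw [← neg_smul]
      exact smul_le_smul_of_nonneg_right (neg_le_abs _) (hd0 b)
    -- For `a` in the ball, each `d b` gets total coefficient at most `∑ |a k| |b k| ≤ 1`, and the
    -- `d b` sum to `y`.
    have h3 : lpSum p (fun k => |V k|) ≤ y := by
      refine (isLUB_lpSum p _).2 ?_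
      rintro _ ⟨a, ha, rfl⟩
      calc ∑ k, a k • |V k| ≤ ∑ k, |a k| • ∑ b ∈ t, |b k| • d b := by
            refine Finset.sum_le_sum fun k _ => ?_
            exact (smul_le_smul_of_nonneg_right (le_abs_self _) (abs_nonneg _)).trans
              (smul_le_smul_of_nonneg_left (habs k) (abs_nonneg _))
        _ = ∑ b ∈ t, (∑ k, |a k| * |b k|) • d b := by
            simp only [Finset.smul_sum, Finset.sum_smul, smul_smul]
            exact Finset.sum_comm
        _ ≤ ∑ b ∈ t, (1 : ℝ) • d b := by
            refine Finset.sum_le_sum fun b hb => ?_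
            exact smul_le_smul_of_nonneg_right (sum_abs_mul_abs_le_one ha (htp b hb)) (hd0 b)
        _ = y := by simp only [one_smul, hdsum]
    have h4 : ‖WithLp.toLp p fun k => ‖V k‖‖ ≤ ‖y‖ :=
      (hL n V).trans (norm_le_of_nonneg_of_le (lpSum_nonneg p _) h3)
    rw [h1]
    calc ∑ k, ξ k (V k) ≤ ∑ k, ‖V k‖ * ν k := by
          refine Finset.sum_le_sum fun k _ => ?_
          refine ((le_abs_self _).trans (DualLattice.abs_apply_le _ _)).trans ?_
          rw [mul_comm]
          exact mul_le_mul_of_nonneg_left (hξ k) (norm_nonneg _)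
      _ ≤ _ := sum_mul_le_norm_mul_norm hp _ _
      _ ≤ ‖y‖ * 1 := by
          have : Fact (1 ≤ p.conjExponent) := ⟨one_le_conjExponent p⟩
          exact mul_le_mul h4 hν (norm_nonneg _) (norm_nonneg _)
      _ = ‖y‖ := mul_one _
  have hHn : ‖H‖ ≤ 1 := by
    refine ContinuousLinearMap.opNorm_le_bound _ zero_le_one fun x => ?_
    have h1 := DualLattice.le_abs_apply H x
    rw [abs_of_nonneg hH0] at h1
    have h2 := hHy |x| (abs_nonneg x)
    rw [norm_abs_eq_norm] at h2
    rw [one_mul]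
    exact h1.trans h2
  refine ⟨H + (δ / (‖W‖ + 1)) • W, ?_, fun b hb => ?_⟩
  · refine (norm_add_le _ _).trans (add_le_add hHn ?_)
    rw [norm_smul, Real.norm_of_nonneg hε.le, div_mul_eq_mul_div, div_le_iff₀ (by positivity)]
    nlinarith [norm_nonneg W]
  · obtain ⟨b', hb', hle⟩ := hnet b hb
    refine hle.trans (add_le_add_left ?_ _)
    exact Finset.le_sup' (fun b : Fin n → ℝ => ∑ k, b k • ξ k) (Finset.mem_insert_of_mem hb')

end Concave
-- The key inequality for convex combinations of elementary tensors.
theorem DualLattice.mono {E : Type u} [NormedAddCommGroup E] [NormedSpace ℝ E] [Lattice E]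
    [IsOrderedAddMonoid E] [HasSolidNorm E] [IsOrderedModule ℝ E] {f : DualLattice E}
    (hf : 0 ≤ f) {x y : E} (h : x ≤ y) : f x ≤ f y := by
  have h1 := hf (y - x) (sub_nonneg.2 h)
  rw [zero_apply, map_sub] at h1
  linarith

/-- Vector-valued seminorms with values in an ordered vector space. -/
structure IsLatticeSeminorm {X : Type u} {E : Type v} [AddCommGroup X] [Module ℝ X]
    [AddCommGroup E] [Module ℝ E] [Lattice E] (m : X → E) : Prop where
  nonneg : ∀ x, 0 ≤ m x
  add_le : ∀ x y, m (x + y) ≤ m x + m y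
  map_smul : ∀ (c : ℝ) x, m (c • x) = |c| • m x

theorem IsLatticeSeminorm.sum_le {X : Type u} {E : Type v} [AddCommGroup X] [Module ℝ X]
    [AddCommGroup E] [Module ℝ E] [Lattice E] [IsOrderedAddMonoid E] {m : X → E}
    (hm : IsLatticeSeminorm m) {ι : Type w} (s : Finset ι) (f : ι → X) :
    m (∑ i ∈ s, f i) ≤ ∑ i ∈ s, m (f i) := by
  refine Finset.le_sum_of_subadditive _ (le_of_eq ?_) hm.add_le s f
  simpa using hm.map_smul 0 0

/-- Every finite family that is dominated by `x₀` has an image that is dominated by some `y₀` with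
`‖y₀‖ ≤ C ‖x₀‖`. -/
def PreservesDomination {X : Type u} {E : Type v} {F : Type w} [Norm E] [LE E] [Zero E]
    [Norm F] [AddGroup F] [Lattice F] (m : X → E) (T : X → F) (C : ℝ) : Prop :=
  ∀ (n : ℕ) (x : Fin n → X) (x₀ : E), 0 ≤ x₀ → (∀ j, m (x j) ≤ x₀) →
    ∃ y₀ : F, 0 ≤ y₀ ∧ (∀ j, |T (x j)| ≤ y₀) ∧ ‖y₀‖ ≤ C * ‖x₀‖

theorem le_of_forall_pos_le_add_mul {a b K : ℝ} (h : ∀ ε : ℝ, 0 < ε → a ≤ b + ε * K) :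
    a ≤ b := by
  refine le_of_forall_pos_le_add fun ε hε => (h (ε / (|K| + 1)) (by positivity)).trans ?_
  gcongr
  rw [div_mul_eq_mul_div, div_le_iff₀ (by positivity)]
  nlinarith [le_abs_self K, abs_nonneg K]

section Key

variable {X : Type u} [AddCommGroup X] [Module ℝ X]
  {E : Type v} [NormedAddCommGroup E] [NormedSpace ℝ E] [Lattice E] [IsOrderedAddMonoid E]
  [HasSolidNorm E] [IsOrderedModule ℝ E] [CompleteSpace E]
  {L : Type w} [NormedAddCommGroup L] [NormedSpace ℝ L] [Lattice L] [IsOrderedAddMonoid L]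
  [HasSolidNorm L] [IsOrderedModule ℝ L] [CompleteSpace L]

/-- Convexity reduces this to the `ℓ_p` norm of the weights, since each `e k` has norm at most `1`.
-/
theorem norm_lpSum_weights_le {p : ℝ≥0∞} (hp : 1 ≤ p) (hE : IsPConvex p E) {N : ℕ}
    {c : Fin N → ℝ} (hc0 : ∀ k, 0 ≤ c k) (hc1 : ∑ k, c k = 1) {e : Fin N → E}
    (he0 : ∀ k, 0 ≤ e k) (he1 : ∀ k, ‖e k‖ ≤ 1) :
    ‖lpSum p fun k => c k ^ (1 / p.toReal) • e k‖ ≤ 1 := by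
  have hw0 : ∀ k, 0 ≤ c k ^ (1 / p.toReal) := fun k => Real.rpow_nonneg (hc0 k) _
  have h := hE N fun k => c k ^ (1 / p.toReal) • e k
  have habs : (fun k => HasModulus.modulus (c k ^ (1 / p.toReal) • e k)) =
      fun k => c k ^ (1 / p.toReal) • e k :=
    funext fun k => abs_of_nonneg (smul_nonneg (hw0 k) (he0 k))
  rw [habs] at h
  refine h.trans (le_trans (norm_toLp_mono hp fun k => ?_) (norm_toLp_weights_le_one hp hc0 hc1))
  rw [abs_norm, norm_smul, Real.norm_of_nonneg (hw0 k), abs_of_nonneg (hw0 k)]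
  exact mul_le_of_le_one_right (hw0 k) (he1 k)

/-- The pairing of a tensor `∑ η_l ⊗ s_l` with a regular operator is controlled by any
representation of the tensor as a convex combination of elementary ones. -/
theorem sum_apply_le_of_convex_combination {p : ℝ≥0∞} (hp : 1 ≤ p) (hE : IsPConvex p E)
    (hL : IsPConcave p L) {m : X → E} (hm : IsLatticeSeminorm m) (S : Submodule ℝ X)
    (T : S →ₗ[ℝ] L) {C : ℝ} (hC : 0 ≤ C) (hT : PreservesDomination (fun s : S => m s) T C)
    {ι : Type*} [Fintype ι] (s : ι → S) (η : ι → DualLattice L) {N : ℕ} {c : Fin N → ℝ}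
    (hc0 : ∀ k, 0 ≤ c k) (hc1 : ∑ k, c k = 1) {n : Fin N → ℕ} (x : ∀ k, Fin (n k) → X)
    (ξ : ∀ k, Fin (n k) → DualLattice L) (e : Fin N → E) (h : Fin N → DualLattice L)
    (hξ0 : ∀ k i, 0 ≤ ξ k i) (he0 : ∀ k, 0 ≤ e k) (he1 : ∀ k, ‖e k‖ ≤ 1) (hh1 : ∀ k, ‖h k‖ ≤ 1)
    (hxe : ∀ k i, m (x k i) ≤ e k) (hξh : ∀ k, ∑ i, ξ k i ≤ h k)
    (heq : ∀ φ : DualLattice L →ₗ[ℝ] ℝ,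
      ∑ l, φ (η l) • (s l : X) = ∑ k, c k • ∑ i, φ (ξ k i) • x k i) :
    ∑ l, η l (T (s l)) ≤ C := by
  set a : Fin N → ℝ := fun k => c k ^ (1 / p.toReal) with ha
  set b : Fin N → ℝ := fun k => c k ^ (1 / p.conjExponent.toReal) with hb
  have hb0 : ∀ k, 0 ≤ b k := fun k => Real.rpow_nonneg (hc0 k) _
  have hab : ∀ k, b k * a k = c k := fun k => by
    rw [mul_comm]; exact weight_mul_weight hp (hc0 k)
  set X₀ : E := lpSum p fun k => a k • e k with hX₀
  have hX₀0 : 0 ≤ X₀ := lpSum_nonneg p _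
  have hX₀1 : ‖X₀‖ ≤ 1 := norm_lpSum_weights_le hp hE hc0 hc1 he0 he1
  refine le_of_forall_pos_le_add_mul (K := C) fun δ hδ => ?_
  obtain ⟨H, hH1, hH⟩ := hL.exists_dual_bound hp (fun k => b k • h k) b
    (fun k => by
      rw [norm_smul, Real.norm_of_nonneg (hb0 k)]
      exact mul_le_of_le_one_right (hb0 k) (hh1 k))
    (norm_toLp_weights_le_one (one_le_conjExponent p) hc0 hc1) hδ
  have hH0 : 0 ≤ H := by simpa using hH 0 zero_mem_polarBall
  -- An order unit large enough that `H`, all `η l`, all `h k`, and therefore all `ξ k i`, lie in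
  -- its ideal.
  set ω : DualLattice L := |H| + ∑ l, |η l| + ∑ k, |h k| with hω
  have hη0 : (0 : DualLattice L) ≤ ∑ l, |η l| := Finset.sum_nonneg fun _ _ => abs_nonneg _
  have hh0 : (0 : DualLattice L) ≤ ∑ k, |h k| := Finset.sum_nonneg fun _ _ => abs_nonneg _
  have hω0 : 0 ≤ ω := add_nonneg (add_nonneg (abs_nonneg _) hη0) hh0
  have hHI : H ∈ principalIdeal ω := ⟨1, by
    rw [one_smul, hω, add_assoc]; exact le_add_of_nonneg_right (add_nonneg hη0 hh0)⟩
  have hηI : ∀ l, η l ∈ principalIdeal ω := fun l => ⟨1, by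
    rw [one_smul]
    refine (Finset.single_le_sum (f := fun l => |η l|) (fun _ _ => abs_nonneg _)
      (Finset.mem_univ l)).trans ?_
    exact (le_add_of_nonneg_left (abs_nonneg _)).trans (le_add_of_nonneg_right hh0)⟩
  have hhI : ∀ k, h k ∈ principalIdeal ω := fun k => ⟨1, by
    rw [one_smul]
    refine (Finset.single_le_sum (f := fun k => |h k|) (fun _ _ => abs_nonneg _)
      (Finset.mem_univ k)).trans ?_
    exact le_add_of_nonneg_left (add_nonneg (abs_nonneg _) hη0)⟩
  have hξI : ∀ k i, ξ k i ∈ principalIdeal ω := fun k i => by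
    refine mem_principalIdeal_of_abs_le (y := h k) ?_ (hhI k)
    rw [abs_of_nonneg (hξ0 k i)]
    exact (Finset.single_le_sum (f := fun i => ξ k i) (fun i _ => hξ0 k i)
      (Finset.mem_univ i)).trans (hξh k)
  refine le_of_forall_pos_le_add_mul (K := 2 * (‖ω‖ * C) + ∑ l, ω |T (s l)|) fun ε hε => ?_
  -- One partition must serve `H` and all `η l` at once; `none` stands for `H`.
  obtain ⟨M, d, φ, hd0, hdsum, hφ, hφd⟩ := exists_partition hω0
    (fun _ h => le_zero_of_forall_le_smul h) (fun o : Option ι => o.elim H η)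
    (fun o => by cases o; exacts [hHI, hηI _]) hε
  have hdH : |H - ∑ j, φ j H • d j| ≤ ε • ω := hφd none
  have hdη : ∀ l, |η l - ∑ j, φ j (η l) • d j| ≤ ε • ω := fun l => hφd (some l)
  -- The added `ε` permits division by `g j`. Its total cost is `ε • ω`, because the `d j` sum to
  -- `ω`.
  set g : Fin M → ℝ := fun j => φ j H + ε with hg
  have hφH : ∀ j, 0 ≤ φ j H := fun j => (hφ j).nonneg hHI hH0
  have hg0 : ∀ j, 0 < g j := fun j => add_pos_of_nonneg_of_pos (hφH j) hε
  -- The tensor evaluated at the point `φ j`. It lies in `S` because it is computed from the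
  -- representation by the `s l`.
  set y : Fin M → S := fun j => ∑ l, φ j (η l) • s l with hy
  have hmy : ∀ j, m (y j : X) ≤ ∑ k, φ j (b k • h k) • a k • e k := by
    intro j
    -- The other representation of the tensor allows the estimate by the `e k`. Since `φ j` is only
    -- known to be linear, `heq` has to cover functionals without continuity.
    have e1 : (y j : X) = ∑ k, c k • ∑ i, φ j (ξ k i) • x k i := by
      rw [← heq]; simp [hy]
    rw [e1]
    refine (hm.sum_le _ _).trans (Finset.sum_le_sum fun k _ => ?_)
    rw [hm.map_smul, abs_of_nonneg (hc0 k), map_smul, smul_smul, smul_eq_mul,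
      mul_right_comm, hab, mul_smul]
    refine smul_le_smul_of_nonneg_left ?_ (hc0 k)
    refine (hm.sum_le _ _).trans ?_
    calc ∑ i, m (φ j (ξ k i) • x k i) ≤ ∑ i, φ j (ξ k i) • e k := by
          refine Finset.sum_le_sum fun i _ => ?_
          have h0 := (hφ j).nonneg (hξI k i) (hξ0 k i)
          rw [hm.map_smul, abs_of_nonneg h0]
          exact smul_le_smul_of_nonneg_left (hxe k i) h0
      _ = φ j (∑ i, ξ k i) • e k := by rw [map_sum, Finset.sum_smul]
      _ ≤ φ j (h k) • e k := smul_le_smul_of_nonneg_right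
          ((hφ j).mono (sum_mem fun i _ => hξI k i) (hhI k) (hξh k)) (he0 k)
  have hgX : ∀ j, m (((g j)⁻¹ • y j : S) : X) ≤ X₀ := by
    intro j
    -- By the bipolar theorem it suffices to pair with the polar ball. There `H` dominates every
    -- combination, and `φ j` preserves this inequality on the ideal.
    have hmem : (fun k => (g j)⁻¹ * φ j (b k • h k)) ∈ conjBall p N := by
      refine mem_conjBall_of_forall_polarBall fun β hβ => ?_
      have h1 : φ j (∑ k, β k • b k • h k) ≤ φ j H :=
        (hφ j).mono (sum_mem fun k _ => Submodule.smul_mem _ _ (Submodule.smul_mem _ _ (hhI k)))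
          hHI (hH β hβ)
      rw [map_sum] at h1
      calc ∑ k, (g j)⁻¹ * φ j (b k • h k) * β k
          = (g j)⁻¹ * ∑ k, φ j (β k • b k • h k) := by
            rw [Finset.mul_sum]
            exact Finset.sum_congr rfl fun k _ => by rw [(φ j).map_smul (β k), smul_eq_mul]; ring
        _ ≤ (g j)⁻¹ * g j := by
            have := inv_pos.2 (hg0 j)
            gcongr
            exact h1.trans (le_add_of_nonneg_right hε.le)
        _ = 1 := inv_mul_cancel₀ (hg0 j).ne'
    have h2 := (isLUB_lpSum p fun k => a k • e k).1 ⟨_, hmem, rfl⟩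
    rw [Submodule.coe_smul, hm.map_smul, abs_of_pos (inv_pos.2 (hg0 j))]
    refine (smul_le_smul_of_nonneg_left (hmy j) (inv_pos.2 (hg0 j)).le).trans (le_trans ?_ h2)
    rw [Finset.smul_sum]
    simp only [smul_smul, mul_assoc]
    exact le_rfl
  -- All normalised vectors lie below the same `X₀`, so one `V` dominates all their images.
  obtain ⟨V, hV0, hV, hVn⟩ := hT M (fun j => (g j)⁻¹ • y j) X₀ hX₀0 hgX
  have hVC : ‖V‖ ≤ C := hVn.trans (mul_le_of_le_one_right hC hX₀1)
  have happrox : ∀ l, η l (T (s l)) ≤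
      ∑ j, φ j (η l) * d j (T (s l)) + ε * ω |T (s l)| := by
    intro l
    have h1 := (le_abs_self _).trans
      (DualLattice.le_abs_apply (η l - ∑ j, φ j (η l) • d j) (T (s l)))
    have h2 := hdη l _ (abs_nonneg (T (s l)))
    rw [DualLattice.sub_apply, DualLattice.sum_apply] at h1
    rw [DualLattice.smul_apply] at h2
    simp only [DualLattice.smul_apply] at h1
    linarith
  have hswap : ∑ l, ∑ j, φ j (η l) * d j (T (s l)) = ∑ j, g j * d j (T ((g j)⁻¹ • y j)) := by
    rw [Finset.sum_comm]
    refine Finset.sum_congr rfl fun j _ => ?_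
    rw [map_smul, map_smul, smul_eq_mul, mul_inv_cancel_left₀ (hg0 j).ne']
    simp [hy, map_sum]
  have hgV : ∑ j, g j * d j (T ((g j)⁻¹ • y j)) ≤ (∑ j, g j • d j) V := by
    rw [DualLattice.sum_apply]
    refine Finset.sum_le_sum fun j _ => ?_
    rw [DualLattice.smul_apply]
    exact mul_le_mul_of_nonneg_left
      (DualLattice.mono (hd0 j) ((le_abs_self _).trans (hV j))) (hg0 j).le
  -- One `ε` comes from approximating `H` on the partition, the other from the `ε` in `g j`.
  have hgH : ∑ j, g j • d j ≤ H + (2 * ε) • ω := by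
    have h1 : ∑ j, g j • d j = ∑ j, φ j H • d j + ε • ω := by
      simp only [hg, add_smul, Finset.sum_add_distrib]
      rw [← Finset.smul_sum, hdsum]
    have h2 : ∑ j, φ j H • d j - H ≤ ε • ω := by
      rw [← neg_sub]; exact (neg_le_abs _).trans hdH
    rw [h1, two_mul, add_smul, ← add_assoc]
    exact add_le_add_left (sub_le_iff_le_add'.1 h2) _
  have hfin := hgH V hV0
  rw [DualLattice.add_apply, DualLattice.smul_apply] at hfin
  have hHV : H V ≤ (1 + δ) * C := ((le_abs_self _).trans (DualLattice.abs_apply_le H V)).trans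
    (mul_le_mul hH1 hVC (norm_nonneg _) (by positivity))
  have hωV : ω V ≤ ‖ω‖ * C := ((le_abs_self _).trans (DualLattice.abs_apply_le ω V)).trans
    (mul_le_mul_of_nonneg_left hVC (norm_nonneg _))
  have hωV' := mul_le_mul_of_nonneg_left hωV (show 0 ≤ 2 * ε by positivity)
  calc ∑ l, η l (T (s l))
      ≤ ∑ l, (∑ j, φ j (η l) * d j (T (s l)) + ε * ω |T (s l)|) :=
        Finset.sum_le_sum fun l _ => happrox l
    _ = ∑ j, g j * d j (T ((g j)⁻¹ • y j)) + ε * ∑ l, ω |T (s l)| := by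
        rw [Finset.sum_add_distrib, hswap, Finset.mul_sum]
    _ ≤ _ := by linarith

end Key
-- The gauge on the tensor product and Hahn–Banach.
section Tensor

open TensorProduct

set_option linter.unusedSectionVars false

variable {X : Type u} [AddCommGroup X] [Module ℝ X]
  {E : Type v} [NormedAddCommGroup E] [NormedSpace ℝ E] [Lattice E] [IsOrderedAddMonoid E]
  [HasSolidNorm E] [IsOrderedModule ℝ E] [CompleteSpace E]
  {L : Type w} [NormedAddCommGroup L] [NormedSpace ℝ L] [Lattice L] [IsOrderedAddMonoid L]
  [HasSolidNorm L] [IsOrderedModule ℝ L] [CompleteSpace L]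

/-- The tensors `∑ x_i ⊗ ξ_i` with `|x_i| ≤ e`, `ξ_i ≥ 0` and `∑ ξ_i ≤ h`, where `‖e‖, ‖h‖ ≤ 1`. -/
def tensorAtoms (L : Type w) [NormedAddCommGroup L] [NormedSpace ℝ L] [Lattice L]
    [IsOrderedAddMonoid L] [HasSolidNorm L] [IsOrderedModule ℝ L] (m : X → E) :
    Set (X ⊗[ℝ] DualLattice L) :=
  {t | ∃ (n : ℕ) (x : Fin n → X) (ξ : Fin n → DualLattice L) (e : E) (h : DualLattice L),
    0 ≤ e ∧ ‖e‖ ≤ 1 ∧ ‖h‖ ≤ 1 ∧ (∀ i, 0 ≤ ξ i) ∧ (∀ i, m (x i) ≤ e) ∧ ∑ i, ξ i ≤ h ∧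
      t = ∑ i, x i ⊗ₜ[ℝ] ξ i}

/-- The vectors are multiplied by `a * b` and the functionals by `b⁻¹`. The positive `b` stands in
for `‖h‖`, which may vanish. -/
theorem smul_sum_tmul_mem_tensorAtoms {m : X → E} (hm : IsLatticeSeminorm m) {n : ℕ}
    (x : Fin n → X) (ξ : Fin n → DualLattice L) {e : E} {h : DualLattice L} (he0 : 0 ≤ e)
    (hξ0 : ∀ i, 0 ≤ ξ i) (hxe : ∀ i, m (x i) ≤ e) (hξh : ∑ i, ξ i ≤ h) {a b : ℝ} (hb : 0 < b)
    (hhb : ‖h‖ ≤ b) (hea : |a| * (‖e‖ * b) ≤ 1) :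
    a • ∑ i, x i ⊗ₜ[ℝ] ξ i ∈ tensorAtoms L m := by
  refine ⟨n, fun i => (a * b) • x i, fun i => b⁻¹ • ξ i, |a * b| • e, b⁻¹ • h,
    smul_nonneg (abs_nonneg _) he0, ?_, ?_, fun i => smul_nonneg (inv_nonneg.2 hb.le) (hξ0 i),
    fun i => ?_, ?_, ?_⟩
  · rw [norm_smul, Real.norm_eq_abs, abs_abs, abs_mul, abs_of_pos hb]
    linarith
  · rw [norm_smul, Real.norm_of_nonneg (inv_nonneg.2 hb.le), inv_mul_le_iff₀ hb, mul_one]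
    exact hhb
  · rw [hm.map_smul]
    exact smul_le_smul_of_nonneg_left (hxe i) (abs_nonneg _)
  · rw [← Finset.smul_sum]
    exact smul_le_smul_of_nonneg_left hξh (inv_nonneg.2 hb.le)
  · rw [Finset.smul_sum]
    refine Finset.sum_congr rfl fun i _ => ?_
    rw [smul_tmul_smul, mul_inv_cancel_right₀ hb.ne']

/-- Split `ξ = ξ⁺ - ξ⁻` and move the minus sign to the vector. -/
theorem exists_sum_tmul_nonneg (t : X ⊗[ℝ] DualLattice L) :
    ∃ (n : ℕ) (x : Fin n → X) (ξ : Fin n → DualLattice L), (∀ i, 0 ≤ ξ i) ∧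
      t = ∑ i, x i ⊗ₜ[ℝ] ξ i := by
  induction t using TensorProduct.induction_on with
  | zero => exact ⟨0, Fin.elim0, Fin.elim0, fun i => i.elim0, by simp⟩
  | tmul x ξ =>
    refine ⟨2, ![x, -x], ![ξ⁺, ξ⁻], fun i => ?_, ?_⟩
    · fin_cases i
      · exact posPart_nonneg ξ
      · exact negPart_nonneg ξ
    · rw [Fin.sum_univ_two]
      simp only [Matrix.cons_val_zero, Matrix.cons_val_one]
      rw [neg_tmul, ← sub_eq_add_neg, ← tmul_sub, posPart_sub_negPart]
  | add t t' ht ht' =>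
    obtain ⟨n, x, ξ, h0, rfl⟩ := ht
    obtain ⟨n', x', ξ', h0', rfl⟩ := ht'
    refine ⟨n + n', Fin.append x x', Fin.append ξ ξ', fun i => ?_, ?_⟩
    · refine Fin.addCases (fun i => ?_) (fun i => ?_) i
      · rw [Fin.append_left]; exact h0 i
      · rw [Fin.append_right]; exact h0' i
    · rw [Fin.sum_univ_add]
      simp only [Fin.append_left, Fin.append_right]

/-- A representation with positive `ξ i` becomes an atom after scaling, with bounds `∑ m (x i)` and
`∑ ξ i`. Hence the gauge is a genuine sublinear functional on the whole tensor product. -/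
theorem absorbent_convexHull_tensorAtoms {m : X → E} (hm : IsLatticeSeminorm m) :
    Absorbent ℝ (convexHull ℝ (tensorAtoms L m)) := by
  refine Absorbent.mono ?_ (subset_convexHull ℝ _)
  rw [absorbent_iff_forall_absorbs_singleton]
  intro t
  obtain ⟨n, x, ξ, hξ0, rfl⟩ := exists_sum_tmul_nonneg t
  set e : E := ∑ i, m (x i) with he
  set h : DualLattice L := ∑ i, ξ i with hh
  have he0 : 0 ≤ e := Finset.sum_nonneg fun i _ => hm.nonneg _
  rw [absorbs_iff_norm]
  refine ⟨‖e‖ * (‖h‖ + 1) + 1, fun c hc => ?_⟩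
  rw [Real.norm_eq_abs] at hc
  have h0 : 0 ≤ ‖e‖ * (‖h‖ + 1) := by positivity
  have hc0 : c ≠ 0 := by
    rintro rfl
    rw [abs_zero] at hc
    linarith
  rw [Set.singleton_subset_iff, Set.mem_smul_set_iff_inv_smul_mem₀ hc0]
  refine smul_sum_tmul_mem_tensorAtoms hm x ξ he0 hξ0
    (fun i => Finset.single_le_sum (f := fun i => m (x i)) (fun i _ => hm.nonneg _)
      (Finset.mem_univ i)) le_rfl (b := ‖h‖ + 1) (by positivity) (by linarith) ?_
  rw [abs_inv, inv_mul_le_iff₀ (abs_pos.2 hc0), mul_one]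
  linarith

/-- The functional `s ⊗ η ↦ η (T s)`. -/
noncomputable def tensorFunctional {S : Type u} [AddCommGroup S] [Module ℝ S] (T : S →ₗ[ℝ] L) :
    S ⊗[ℝ] DualLattice L →ₗ[ℝ] ℝ :=
  TensorProduct.lift (LinearMap.mk₂ ℝ (fun s η => η (T s))
    (fun s s' η => by rw [map_add, map_add])
    (fun c s η => by rw [map_smul, map_smul])
    (fun s η η' => DualLattice.add_apply _ _ _)
    (fun c s η => DualLattice.smul_apply _ _ _))

theorem tensorFunctional_tmul {S : Type u} [AddCommGroup S] [Module ℝ S] (T : S →ₗ[ℝ] L) (s : S)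
    (η : DualLattice L) : tensorFunctional T (s ⊗ₜ[ℝ] η) = η (T s) := rfl

theorem tensorFunctional_le_of_mem_convexHull {p : ℝ≥0∞} (hp : 1 ≤ p) (hE : IsPConvex p E)
    (hL : IsPConcave p L) {m : X → E} (hm : IsLatticeSeminorm m) (S : Submodule ℝ X)
    (T : S →ₗ[ℝ] L) {C : ℝ} (hC : 0 ≤ C) (hT : PreservesDomination (fun s : S => m s) T C)
    (t : S ⊗[ℝ] DualLattice L)
    (ht : S.subtype.rTensor (DualLattice L) t ∈ convexHull ℝ (tensorAtoms L m)) :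
    tensorFunctional T t ≤ C := by
  obtain ⟨κ, _, c, z, hc0, hc1, hz, hsum⟩ := mem_convexHull_iff_exists_fintype.1 ht
  choose n x ξ e h he0 he1 hh1 hξ0 hxe hξh hzeq using hz
  obtain ⟨R, rfl⟩ := TensorProduct.exists_finset t
  let σ := (Fintype.equivFin κ).symm
  have key := sum_apply_le_of_convex_combination hp hE hL hm S T hC hT
    (fun l : R => l.1.1) (fun l : R => l.1.2) (c := fun k => c (σ k)) (fun k => hc0 _)
    ((σ.sum_comp c).trans hc1) (fun k => x (σ k)) (fun k => ξ (σ k)) (fun k => e (σ k))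
    (fun k => h (σ k)) (fun k => hξ0 _) (fun k => he0 _) (fun k => he1 _) (fun k => hh1 _)
    (fun k => hxe _) (fun k => hξh _) (by
      intro φ
      rw [σ.sum_comp fun k => c k • ∑ i, φ (ξ k i) • x k i]
      -- Applying `φ` to the second factor converts the equality of tensors into the equalities of
      -- vectors demanded by the key inequality.
      let F : X ⊗[ℝ] DualLattice L →ₗ[ℝ] X :=
        TensorProduct.lift (LinearMap.mk₂ ℝ (fun x η => φ η • x)
          (fun x x' η => smul_add _ _ _) (fun c x η => smul_comm _ _ _)
          (fun x η η' => by rw [map_add, add_smul])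
          (fun c x η => by rw [map_smul, smul_eq_mul, mul_smul]))
      have hF : ∀ x η, F (x ⊗ₜ[ℝ] η) = φ η • x := fun x η => rfl
      have h2 := congrArg F hsum
      simp only [map_sum, map_smul, hzeq, LinearMap.rTensor_tmul, hF, Submodule.subtype_apply]
        at h2
      rw [h2, Finset.sum_coe_sort R fun l => φ l.2 • (l.1 : X)])
  rw [map_sum]
  simp only [tensorFunctional_tmul]
  rwa [Finset.sum_coe_sort R fun l => l.2 (T l.1)] at key

/-- Extension of the bilinear form `(s, η) ↦ η (T s)`. -/
theorem exists_bilinear_extension {p : ℝ≥0∞} (hp : 1 ≤ p) (hE : IsPConvex p E)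
    (hL : IsPConcave p L) {m : X → E} (hm : IsLatticeSeminorm m) (S : Submodule ℝ X)
    (T : S →ₗ[ℝ] L) {C : ℝ} (hC : 0 ≤ C) (hT : PreservesDomination (fun s : S => m s) T C) :
    ∃ W : X →ₗ[ℝ] DualLattice L →ₗ[ℝ] ℝ, (∀ (s : S) η, W s η = η (T s)) ∧
      ∀ (n : ℕ) (x : Fin n → X) (ξ : Fin n → DualLattice L) (e : E), 0 ≤ e →
        (∀ i, 0 ≤ ξ i) → (∀ i, m (x i) ≤ e) →
        ∑ i, W (x i) (ξ i) ≤ C * (‖e‖ * ‖∑ i, ξ i‖) := by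
  set K := convexHull ℝ (tensorAtoms L m) with hK
  have habs : Absorbent ℝ K := absorbent_convexHull_tensorAtoms hm
  have hconv : Convex ℝ K := convex_convexHull ℝ _
  set j := S.subtype.rTensor (DualLattice L) with hj
  -- Flatness identifies `S ⊗ L*` with a subspace of `X ⊗ L*`, so the functional is well defined on
  -- the range of `j`.
  have hinj : Function.Injective j :=
    Module.Flat.rTensor_preserves_injective_linearMap _ S.injective_subtype
  let f : (X ⊗[ℝ] DualLattice L) →ₗ.[ℝ] ℝ :=
    ⟨LinearMap.range j, tensorFunctional T ∘ₗ (LinearEquiv.ofInjective j hinj).symm.toLinearMap⟩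
  have hfj : ∀ (t) (ht : j t ∈ f.domain), f ⟨j t, ht⟩ = tensorFunctional T t := by
    intro t ht
    change tensorFunctional T ((LinearEquiv.ofInjective j hinj).symm ⟨j t, ht⟩) = _
    congr 1
    rw [LinearEquiv.symm_apply_eq]
    rfl
  obtain ⟨g, hgf, hg⟩ := exists_extension_of_le_sublinear f (fun t => C * gauge K t)
    (fun c hc t => by rw [gauge_smul_of_nonneg hc.le, smul_eq_mul]; ring)
    (fun t t' => by
      rw [← mul_add]
      exact mul_le_mul_of_nonneg_left (gauge_add_le hconv habs t t') hC) (by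
      rintro ⟨_, t, rfl⟩
      refine (hfj t ⟨t, rfl⟩).trans_le ?_
      refine le_of_forall_pos_le_add_mul (K := C) fun ε hε => ?_
      -- For `b` slightly above the gauge, `b⁻¹ • t` maps into the hull, where the key inequality
      -- applies.
      obtain ⟨b, hb0, hb, hmem⟩ := exists_lt_of_gauge_lt habs
        (lt_add_of_pos_right (gauge K (j t)) hε)
      rw [Set.mem_smul_set_iff_inv_smul_mem₀ hb0.ne', ← map_smul] at hmem
      have h1 := tensorFunctional_le_of_mem_convexHull hp hE hL hm S T hC hT _ hmem
      rw [map_smul, smul_eq_mul, inv_mul_le_iff₀ hb0] at h1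
      calc tensorFunctional T t ≤ b * C := h1
        _ ≤ (gauge K (j t) + ε) * C := mul_le_mul_of_nonneg_right hb.le hC
        _ = C * gauge K (j t) + ε * C := by ring)
  refine ⟨TensorProduct.curry g, fun s η => ?_, fun n x ξ e he0 hξ0 hxe => ?_⟩
  · rw [TensorProduct.curry_apply]
    have h1 : j (s ⊗ₜ[ℝ] η) = (s : X) ⊗ₜ[ℝ] η := by simp [hj]
    have h2 := hgf ⟨j (s ⊗ₜ[ℝ] η), s ⊗ₜ[ℝ] η, rfl⟩
    rw [← h1]
    exact h2.trans (hfj (s ⊗ₜ[ℝ] η) ⟨_, rfl⟩)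
  · set h := ∑ i, ξ i with hh
    simp only [TensorProduct.curry_apply]
    rw [← map_sum]
    set t := ∑ i, x i ⊗ₜ[ℝ] ξ i with ht
    -- Enlarging both norms by `ε` avoids dividing by zero; afterwards `ε` tends to `0`.
    have hbound : ∀ ε : ℝ, 0 < ε → g t ≤ C * ((‖e‖ + ε) * (‖h‖ + ε)) := by
      intro ε hε
      have hpos : 0 < (‖e‖ + ε) * (‖h‖ + ε) := by positivity
      have h1 : ((‖e‖ + ε) * (‖h‖ + ε))⁻¹ • t ∈ tensorAtoms L m := by
        refine smul_sum_tmul_mem_tensorAtoms hm x ξ he0 hξ0 hxe le_rfl (b := ‖h‖ + ε)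
          (by positivity) (by linarith) ?_
        rw [abs_of_pos (inv_pos.2 hpos), inv_mul_le_iff₀ hpos, mul_one]
        gcongr
        linarith
      have h2 := (hg _).trans (mul_le_mul_of_nonneg_left
        (gauge_le_one_of_mem (subset_convexHull ℝ _ h1)) hC)
      rw [map_smul, smul_eq_mul, inv_mul_le_iff₀ hpos, mul_one] at h2
      linarith
    have hlim : Filter.Tendsto (fun ε : ℝ => C * ((‖e‖ + ε) * (‖h‖ + ε)))
        (nhdsWithin 0 (Set.Ioi 0)) (nhds (C * ((‖e‖ + 0) * (‖h‖ + 0)))) := by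
      have : Continuous fun ε : ℝ => C * ((‖e‖ + ε) * (‖h‖ + ε)) := by fun_prop
      exact (this.tendsto 0).mono_left nhdsWithin_le_nhds
    rw [add_zero, add_zero] at hlim
    exact ge_of_tendsto hlim (by filter_upwards [self_mem_nhdsWithin] with ε hε using hbound ε hε)

end Tensor
-- From bilinear forms to operators into the bidual.
section Bidual

set_option linter.unusedSectionVars false

variable {X : Type u} [AddCommGroup X] [Module ℝ X]
  {E : Type v} [NormedAddCommGroup E] [NormedSpace ℝ E] [Lattice E] [IsOrderedAddMonoid E]
  [HasSolidNorm E] [IsOrderedModule ℝ E] [CompleteSpace E]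
  {L : Type w} [NormedAddCommGroup L] [NormedSpace ℝ L] [Lattice L] [IsOrderedAddMonoid L]
  [HasSolidNorm L] [IsOrderedModule ℝ L] [CompleteSpace L]

/-- Regular extension with values in the bidual. -/
theorem exists_bidual_extension {p : ℝ≥0∞} (hp : 1 ≤ p) (hE : IsPConvex p E)
    (hL : IsPConcave p L) {m : X → E} (hm : IsLatticeSeminorm m) (S : Submodule ℝ X)
    (T : S →ₗ[ℝ] L) {C : ℝ} (hC : 0 ≤ C) (hT : PreservesDomination (fun s : S => m s) T C) :
    ∃ V : X →ₗ[ℝ] DualLattice (DualLattice L), (∀ s : S, V s = DualLattice.toBidual (T s)) ∧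
      ∀ (t : Finset X) (ht : t.Nonempty) (e : E), 0 ≤ e → (∀ x ∈ t, m x ≤ e) →
        ∀ ξ : DualLattice L, 0 ≤ ξ → t.sup' ht V ξ ≤ C * (‖e‖ * ‖ξ‖) := by
  obtain ⟨W, hWS, hW⟩ := exists_bilinear_extension hp hE hL hm S T hC hT
  have hle : ∀ x ξ, W x ξ ≤ C * ‖m x‖ * ‖ξ‖ := by
    intro x ξ
    -- These two terms add up to `W x ξ`, while the functionals `ξ⁺` and `ξ⁻` add up to `|ξ|`, which
    -- has the norm of `ξ`.
    have h := hW 2 ![x, -x] ![ξ⁺, ξ⁻] (m x) (hm.nonneg x)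
      (fun i => by
        fin_cases i
        · exact posPart_nonneg ξ
        · exact negPart_nonneg ξ)
      (fun i => by
        fin_cases i
        · exact le_rfl
        · have := hm.map_smul (-1) x
          rw [abs_neg, abs_one, one_smul, neg_one_smul] at this
          exact this.le)
    simp only [Fin.sum_univ_two, Matrix.cons_val_zero, Matrix.cons_val_one] at h
    rw [posPart_add_negPart, norm_abs_eq_norm, map_neg, LinearMap.neg_apply, ← sub_eq_add_neg,
      ← map_sub, posPart_sub_negPart] at h
    linarith
  have habs : ∀ x ξ, ‖W x ξ‖ ≤ C * ‖m x‖ * ‖ξ‖ := by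
    intro x ξ
    rw [Real.norm_eq_abs, abs_le']
    refine ⟨hle x ξ, ?_⟩
    have := hle x (-ξ)
    rwa [map_neg, norm_neg] at this
  let V : X →ₗ[ℝ] DualLattice (DualLattice L) :=
    { toFun := fun x => LinearMap.mkContinuous (W x) (C * ‖m x‖) (habs x)
      map_add' := fun x y => DualLattice.ext' fun ξ => by
        change W (x + y) ξ = W x ξ + W y ξ
        rw [map_add]; rfl
      map_smul' := fun c x => DualLattice.ext' fun ξ => by
        change W (c • x) ξ = c * W x ξ
        rw [map_smul]; rfl }
  have hV : ∀ x ξ, V x ξ = W x ξ := fun x ξ => rfl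
  refine ⟨V, fun s => DualLattice.ext' fun ξ => ?_, fun t ht e he hte ξ hξ => ?_⟩
  · rw [hV, hWS, DualLattice.toBidual_apply]
  · refine le_of_forall_pos_le_add fun ε hε => ?_
    -- Evaluating the supremum at `ξ` costs only a splitting of `ξ` into positive pieces, which is
    -- the kind of sum that `hW` bounds.
    obtain ⟨d, hd0, hdsum, hd⟩ := DualLattice.exists_sum_of_sup' ht V ξ hξ ε hε
    refine hd.trans (add_le_add_left ?_ ε)
    let σ := t.equivFin.symm
    have h := hW t.card (fun i => (σ i : X)) (fun i => d (σ i)) e he (fun i => hd0 _)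
      (fun i => hte _ (σ i).2)
    rw [σ.sum_comp fun x : t => d x, σ.sum_comp fun x : t => W x (d x), Finset.sum_coe_sort t d,
      Finset.sum_coe_sort t fun x => W x (d x), hdsum] at h
    exact h

/-- The norm of a positive element of the bidual that is almost dominated by finite suprema of
values of a regular operator. -/
theorem norm_le_of_forall_le_sup' {m : X → E} {V : X → DualLattice (DualLattice L)} {C : ℝ}
    (hC : 0 ≤ C)
    (hV : ∀ (t : Finset X) (ht : t.Nonempty) (e : E), 0 ≤ e → (∀ x ∈ t, m x ≤ e) →
        ∀ ξ : DualLattice L, 0 ≤ ξ → t.sup' ht V ξ ≤ C * (‖e‖ * ‖ξ‖))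
    {Z R : DualLattice (DualLattice L)} (hZ : 0 ≤ Z) {e : E} (he : 0 ≤ e)
    (h : ∀ ε : ℝ, 0 < ε → ∃ (t : Finset X) (ht : t.Nonempty), (∀ x ∈ t, m x ≤ e) ∧
      Z ≤ t.sup' ht V + ε • R) : ‖Z‖ ≤ C * ‖e‖ := by
  have hpos : ∀ ξ : DualLattice L, 0 ≤ ξ → Z ξ ≤ C * (‖e‖ * ‖ξ‖) := by
    intro ξ hξ
    refine le_of_forall_pos_le_add_mul (K := R ξ) fun ε hε => ?_
    obtain ⟨t, ht, hte, hZt⟩ := h ε hε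
    have h1 := hZt ξ hξ
    rw [DualLattice.add_apply, DualLattice.smul_apply] at h1
    linarith [hV t ht e he hte ξ hξ]
  refine ContinuousLinearMap.opNorm_le_bound _ (by positivity) fun ξ => ?_
  have h1 := DualLattice.le_abs_apply Z ξ
  rw [abs_of_nonneg hZ] at h1
  have h2 := hpos |ξ| (abs_nonneg ξ)
  rw [norm_abs_eq_norm] at h2
  rw [mul_assoc]
  exact h1.trans h2

end Bidual

/-! ### Calculus of regular bounds. -/

section Regular

variable {X Y Z : Type*} {E F G : Type*} [HasModulus X E] [HasModulus Y F] [HasModulus Z G]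
  [Norm E] [Lattice E] [Norm F] [Lattice F] [Norm G] [Lattice G]

theorem regularNorm_nonneg (T : X → Y) : 0 ≤ regularNorm T :=
  Real.sInf_nonneg fun _ hC => hC.1

/-- The defining infimum is attained because the inequalities are closed in the constant. -/
theorem IsRegularOp.hasRegularBound {E : Type*} [NormedAddCommGroup E] [Lattice E]
    [HasModulus X E] {T : X → Y} (hT : IsRegularOp T) : HasRegularBound T (regularNorm T) := by
  refine ⟨regularNorm_nonneg T, fun n x => ?_⟩
  refine le_of_forall_pos_le_add_mul
    (K := ‖Finset.univ.sup' Finset.univ_nonempty fun i => HasModulus.modulus (x i)‖)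
    fun ε hε => ?_
  obtain ⟨C, hC, hlt⟩ := exists_lt_of_csInf_lt (s := {C | HasRegularBound T C}) hT
    (lt_add_of_pos_right (regularNorm T) hε)
  refine (hC.2 n x).trans ?_
  rw [← add_mul]
  exact mul_le_mul_of_nonneg_right hlt.le (norm_nonneg _)

theorem HasRegularBound.mono {E : Type*} [NormedAddCommGroup E] [Lattice E] [HasModulus X E]
    {T : X → Y} {C D : ℝ} (hT : HasRegularBound T C) (h : C ≤ D) : HasRegularBound T D :=
  ⟨hT.1.trans h, fun n x => (hT.2 n x).trans (mul_le_mul_of_nonneg_right h (norm_nonneg _))⟩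

theorem HasRegularBound.comp {T : X → Y} {P : Y → Z} {C D : ℝ} (hP : HasRegularBound P D)
    (hT : HasRegularBound T C) : HasRegularBound (fun x => P (T x)) (D * C) :=
  ⟨mul_nonneg hP.1 hT.1, fun n x => (hP.2 n fun i => T (x i)).trans (by
    rw [mul_assoc]
    exact mul_le_mul_of_nonneg_left (hT.2 n x) hP.1)⟩

/-- Every regular bound of the extension restricts to one of `T`, so the norm cannot drop. -/
theorem regularNorm_eq_of_extends {𝕜 : Type*} [Semiring 𝕜] [AddCommMonoid X] [Module 𝕜 X]
    {S : Submodule 𝕜 X} {T : S → Y} {T' : X → Y} (hext : ∀ s : S, T' s = T s)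
    (hT' : HasRegularBound T' (regularNorm T)) : regularNorm T' = regularNorm T := by
  refine le_antisymm (csInf_le ⟨0, fun _ hC => hC.1⟩ hT') ?_
  refine csInf_le_csInf ⟨0, fun _ hC => hC.1⟩ ⟨_, hT'⟩ fun C hC => ⟨hC.1, fun n x => ?_⟩
  have h := hC.2 n fun i => (x i : X)
  simp only [hext] at h
  exact h

/-- Regularity enters the key inequality in this form, with `R` the identity in the real case and
the real part in the complex case. A regular bound concerns nonempty families only, so the empty
family is given `y₀ = 0`. -/
theorem HasRegularBound.preservesDomination {X Y E F : Type*} [HasModulus X E]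
    [NormedAddCommGroup E] [Lattice E] [IsOrderedAddMonoid E] [HasSolidNorm E]
    [HasModulus Y F] [NormedAddCommGroup F] [Lattice F] [IsOrderedAddMonoid F]
    (hX : ∀ x : X, 0 ≤ HasModulus.modulus x) {T : X → Y} {C : ℝ} (hT : HasRegularBound T C)
    {R : Y → F} (hR : ∀ y, |R y| ≤ HasModulus.modulus y) :
    PreservesDomination (HasModulus.modulus : X → E) (fun x => R (T x)) C := by
  rintro (_ | n) x x₀ hx₀ hx
  · exact ⟨0, le_rfl, fun j => j.elim0, by
      rw [norm_zero]; exact mul_nonneg hT.1 (norm_nonneg _)⟩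
  · have hle : ∀ j, |R (T (x j))| ≤
        Finset.univ.sup' Finset.univ_nonempty fun i => HasModulus.modulus (T (x i)) := fun j =>
      (hR _).trans (Finset.le_sup' (fun i => HasModulus.modulus (T (x i))) (Finset.mem_univ j))
    refine ⟨_, (abs_nonneg _).trans (hle 0), hle, (hT.2 n x).trans ?_⟩
    refine mul_le_mul_of_nonneg_left (norm_le_of_nonneg_of_le ?_ ?_) hT.1
    · exact (hX (x 0)).trans
        (Finset.le_sup' (fun i => HasModulus.modulus (x i)) (Finset.mem_univ 0))
    · exact Finset.sup'_le _ _ fun i _ => hx i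

end Regular

/-! ### Projections from the bidual and passage between real and complex lattices. -/

section Projection

set_option linter.unusedSectionVars false

variable {L : Type v} [NormedAddCommGroup L] [NormedSpace ℝ L] [Lattice L] [IsOrderedAddMonoid L]
  [HasSolidNorm L] [IsOrderedModule ℝ L] [CompleteSpace L]

/-- A dual lattice is the range of a positive contractive projection on its bidual. -/
theorem IsDualLattice.exists_projection (hL : IsDualLattice.{v, w} L) :
    ∃ P : DualLattice (DualLattice L) →L[ℝ] L, (∀ y : L, P (DualLattice.toBidual y) = y) ∧
      (∀ Ψ, 0 ≤ Ψ → 0 ≤ P Ψ) ∧ ∀ Ψ, ‖P Ψ‖ ≤ ‖Ψ‖ := by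
  obtain ⟨M, _, _, _, _, _, _, _, e, he⟩ := hL
  -- The canonical map of the predual `M` into `L*`. Restricting functionals on `L*` along it gives
  -- `L** → M*`, and `e.symm` identifies `M*` with `L`.
  let q : M → DualLattice L := fun x => LinearMap.mkContinuous
    { toFun := fun y => e y x
      map_add' := fun y z => by rw [map_add]; rfl
      map_smul' := fun c y => by rw [map_smul]; rfl } ‖x‖ (fun y => by
        have := DualLattice.abs_apply_le (e y) x
        rw [e.norm_map, mul_comm] at this
        exact this)
  have hq : ∀ x y, q x y = e y x := fun x y => rfl
  have hqn : ∀ x, ‖q x‖ ≤ ‖x‖ := fun x => LinearMap.mkContinuous_norm_le _ (norm_nonneg x) _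
  have hqadd : ∀ x y, q (x + y) = q x + q y := fun x y => DualLattice.ext' fun z => by
    rw [DualLattice.add_apply, hq, hq, hq, map_add]
  have hqsmul : ∀ (c : ℝ) x, q (c • x) = c • q x := fun c x => DualLattice.ext' fun z => by
    rw [DualLattice.smul_apply, hq, hq, map_smul, smul_eq_mul]
  have hq0 : ∀ x, 0 ≤ x → 0 ≤ q x := by
    intro x hx y hy
    have h1 : e 0 ≤ e y := (he 0 y).2 hy
    rw [map_zero] at h1
    exact h1 x hx
  let R : DualLattice (DualLattice L) → DualLattice M := fun Ψ => LinearMap.mkContinuous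
    { toFun := fun x => Ψ (q x)
      map_add' := fun x y => by rw [hqadd, map_add]
      map_smul' := fun c x => by rw [hqsmul, map_smul]; rfl } ‖Ψ‖ (fun x =>
        (DualLattice.abs_apply_le Ψ (q x)).trans
          (mul_le_mul_of_nonneg_left (hqn x) (norm_nonneg Ψ)))
  have hR : ∀ Ψ x, R Ψ x = Ψ (q x) := fun Ψ x => rfl
  have hRn : ∀ Ψ, ‖R Ψ‖ ≤ ‖Ψ‖ := fun Ψ => LinearMap.mkContinuous_norm_le _ (norm_nonneg Ψ) _
  have hRadd : ∀ Ψ Φ, R (Ψ + Φ) = R Ψ + R Φ := fun Ψ Φ => rfl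
  have hRsmul : ∀ (c : ℝ) Ψ, R (c • Ψ) = c • R Ψ := fun c Ψ => rfl
  have hP : ∀ Ψ, ‖e.symm (R Ψ)‖ ≤ ‖Ψ‖ := fun Ψ => by
    rw [e.symm.norm_map]; exact hRn Ψ
  refine ⟨LinearMap.mkContinuous
    { toFun := fun Ψ => e.symm (R Ψ)
      map_add' := fun Ψ Φ => by rw [hRadd, map_add]
      map_smul' := fun c Ψ => by rw [hRsmul, map_smul]; rfl } 1 (fun Ψ => by
        rw [one_mul]; exact hP Ψ), fun y => ?_, fun Ψ hΨ => ?_, hP⟩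
  · change e.symm (R (DualLattice.toBidual y)) = y
    rw [e.symm_apply_eq]
    exact DualLattice.ext' fun x => rfl
  · change 0 ≤ e.symm (R Ψ)
    rw [← he, map_zero, e.apply_symm_apply]
    exact fun x hx => hΨ (q x) (hq0 x hx)

variable {B : Type u} [NormedAddCommGroup B] [NormedSpace ℝ B] [Lattice B] [IsOrderedAddMonoid B]
  [HasSolidNorm B] [IsOrderedModule ℝ B] [CompleteSpace B]

theorem map_mono_of_nonneg {P : B →L[ℝ] L} (hP : ∀ x, 0 ≤ x → 0 ≤ P x) {x y : B} (h : x ≤ y) :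
    P x ≤ P y := by
  have := hP (y - x) (sub_nonneg.2 h)
  rwa [map_sub, sub_nonneg] at this

theorem hasRegularBound_one_of_modulus_le {X Y : Type*} [HasModulus X B] [HasModulus Y L]
    {P : B →L[ℝ] L} (hP : ∀ x, 0 ≤ x → 0 ≤ P x) (hPn : ∀ x, ‖P x‖ ≤ ‖x‖)
    (hY : ∀ y : Y, 0 ≤ HasModulus.modulus y) {T : X → Y}
    (hT : ∀ x, HasModulus.modulus (T x) ≤ P (HasModulus.modulus x)) : HasRegularBound T 1 := by
  refine ⟨zero_le_one, fun n x => ?_⟩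
  rw [one_mul]
  refine le_trans (norm_le_of_nonneg_of_le ?_ (Finset.sup'_le _ _ fun i _ => ?_)) (hPn _)
  · exact (hY (T (x 0))).trans
      (Finset.le_sup' (fun i => HasModulus.modulus (T (x i))) (Finset.mem_univ 0))
  · exact (hT (x i)).trans (map_mono_of_nonneg hP
      (Finset.le_sup' (fun i => HasModulus.modulus (x i)) (Finset.mem_univ i)))

theorem hasRegularBound_one_of_nonneg {P : B →L[ℝ] L} (hP : ∀ x, 0 ≤ x → 0 ≤ P x)
    (hPn : ∀ x, ‖P x‖ ≤ ‖x‖) : HasRegularBound P 1 := by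
  refine hasRegularBound_one_of_modulus_le hP hPn (fun y => abs_nonneg y) fun x => ?_
  refine abs_le'.2 ⟨map_mono_of_nonneg hP (le_abs_self x), ?_⟩
  rw [← map_neg]
  exact map_mono_of_nonneg hP (neg_le_abs x)

namespace Complexification

/-- The modulus is a supremum of elements `Re (c z)`. Acting with `P` on both coordinates commutes
with `Re (c ·)`, and positivity preserves the inequalities. -/
theorem modulus_map_le {P : B →L[ℝ] L} (hP : ∀ x, 0 ≤ x → 0 ≤ P x) (z : Complexification B) :
    modulus (⟨P z.re, P z.im⟩ : Complexification L) ≤ P (modulus z) := by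
  refine modulus_le fun c hc => ?_
  have h := map_mono_of_nonneg hP (re_smul_le_modulus hc z)
  simpa using h

theorem exists_map {P : B →L[ℝ] L} (hP : ∀ x, 0 ≤ x → 0 ≤ P x) (hPn : ∀ x, ‖P x‖ ≤ ‖x‖) :
    ∃ Q : Complexification B →L[ℂ] Complexification L, (∀ z, Q z = ⟨P z.re, P z.im⟩) ∧
      HasRegularBound Q 1 := by
  have hle := fun z => modulus_map_le (L := L) hP z
  refine ⟨LinearMap.mkContinuous
    { toFun := fun z => ⟨P z.re, P z.im⟩
      map_add' := fun z w => by ext <;> simp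
      map_smul' := fun c z => by ext <;> simp } 1 (fun z => ?_), fun z => rfl, ?_⟩
  · rw [one_mul]
    exact (norm_le_of_nonneg_of_le (modulus_nonneg _) (hle z)).trans (hPn _)
  · exact hasRegularBound_one_of_modulus_le hP hPn (fun y => modulus_nonneg y) fun x => hle x

theorem modulus_ofReal (y : L) : modulus (⟨y, 0⟩ : Complexification L) = |y| := by
  refine le_antisymm (modulus_le fun c hc => ?_) (abs_re_le_modulus (⟨y, 0⟩ : Complexification L))
  simp only [smul_re, smul_zero, sub_zero]
  refine (smul_le_abs_smul_abs _ _).trans ?_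
  calc |c.re| • |y| ≤ (1 : ℝ) • |y| :=
        smul_le_smul_of_nonneg_right ((Complex.abs_re_le_norm c).trans hc) (abs_nonneg y)
    _ = |y| := one_smul _ _

theorem norm_ofReal (y : L) : ‖(⟨y, 0⟩ : Complexification L)‖ = ‖y‖ := by
  rw [norm_def, modulus_ofReal, norm_abs_eq_norm]

end Complexification

/-- The embedding `y ↦ y + i0` preserves moduli and norms. -/
theorem IsPConcave.of_complexification {p : ℝ≥0∞} (h : IsPConcave p (Complexification L)) :
    IsPConcave p L := by
  intro n x
  have h1 := h n fun i => ⟨x i, 0⟩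
  simp only [Complexification.norm_ofReal] at h1
  simp only [HasModulus.modulus, Complexification.modulus_ofReal] at h1
  exact h1

theorem IsPConvex.of_complexification {p : ℝ≥0∞} (h : IsPConvex p (Complexification L)) :
    IsPConvex p L := by
  intro n x
  have h1 := h n fun i => ⟨x i, 0⟩
  simp only [Complexification.norm_ofReal] at h1
  simp only [HasModulus.modulus, Complexification.modulus_ofReal] at h1
  exact h1

end Projection
-- Regular extensions into the bidual, real and complex.
section Extension

variable {Λ : Type u} [NormedAddCommGroup Λ] [NormedSpace ℝ Λ] [Lattice Λ] [IsOrderedAddMonoid Λ]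
  [HasSolidNorm Λ] [IsOrderedModule ℝ Λ] [CompleteSpace Λ]
  {L : Type v} [NormedAddCommGroup L] [NormedSpace ℝ L] [Lattice L] [IsOrderedAddMonoid L]
  [HasSolidNorm L] [IsOrderedModule ℝ L] [CompleteSpace L]

theorem isLatticeSeminorm_abs : IsLatticeSeminorm (fun x : Λ => |x|) := by
  have hle : ∀ (c : ℝ) (x : Λ), |c • x| ≤ |c| • |x| := fun c x =>
    abs_le'.2 ⟨smul_le_abs_smul_abs c x, by
      rw [← neg_smul, ← abs_neg c]; exact smul_le_abs_smul_abs (-c) x⟩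
  refine ⟨fun x => abs_nonneg x, fun x y => abs_add_le x y, fun c x => le_antisymm (hle c x) ?_⟩
  rcases eq_or_ne c 0 with rfl | hc
  · simp
  · have h := smul_le_smul_of_nonneg_left (hle c⁻¹ (c • x)) (abs_nonneg c)
    rwa [inv_smul_smul₀ hc, abs_inv, smul_inv_smul₀ (abs_pos.2 hc).ne'] at h

theorem HasRegularBound.modulus_norm_le {X Y E F : Type*} [HasModulus X E] [HasModulus Y F]
    [Norm E] [Lattice E] [Norm F] [Lattice F] {T : X → Y} {C : ℝ} (hT : HasRegularBound T C)
    (x : X) : ‖HasModulus.modulus (T x)‖ ≤ C * ‖HasModulus.modulus x‖ := by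
  have h := hT.2 0 fun _ => x
  simpa only [Finset.sup'_const] using h

theorem exists_regular_bidual_extension {p : ℝ≥0∞} (hp : 1 ≤ p) (hΛ : IsPConvex p Λ)
    (hL : IsPConcave p L) (S : Submodule ℝ Λ) (T : S →L[ℝ] L) {C : ℝ}
    (hT : HasRegularBound T C) :
    ∃ V : Λ →L[ℝ] DualLattice (DualLattice L), (∀ s : S, V s = DualLattice.toBidual (T s)) ∧
      HasRegularBound V C := by
  classical
  have hdom := hT.preservesDomination (X := S) (fun s => abs_nonneg (s : Λ)) (R := fun y : L => y)
    fun y => le_refl |y|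
  obtain ⟨V, hVS, hV⟩ := exists_bidual_extension hp hΛ hL isLatticeSeminorm_abs S T.toLinearMap
    hT.1 hdom
  have hreg : HasRegularBound V C := by
    refine ⟨hT.1, fun n x => ?_⟩
    have hx : ∀ i, |x i| ≤ Finset.univ.sup' Finset.univ_nonempty fun i => |x i| := fun i =>
      Finset.le_sup' (fun i => |x i|) (Finset.mem_univ i)
    -- Adding the vectors `-x i` turns the moduli `|V (x i)|` into a finite supremum of values of
    -- `V`, so no error term is needed.
    refine norm_le_of_forall_le_sup' (R := 0) hT.1 hV ?_ ((abs_nonneg _).trans (hx 0))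
      fun ε _ => ⟨Finset.univ.image x ∪ Finset.univ.image fun i => -x i, ⟨x 0, by simp⟩, ?_, ?_⟩
    · exact (abs_nonneg (V (x 0))).trans
        (Finset.le_sup' (fun i => |V (x i)|) (Finset.mem_univ 0))
    · intro z hz
      simp only [Finset.mem_union, Finset.mem_image, Finset.mem_univ, true_and] at hz
      rcases hz with ⟨i, rfl⟩ | ⟨i, rfl⟩
      · exact hx i
      · rw [abs_neg]; exact hx i
    · rw [smul_zero, add_zero]
      refine Finset.sup'_le _ _ fun i _ => abs_le'.2 ⟨?_, ?_⟩
      · exact Finset.le_sup' V (by simp)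
      · rw [← map_neg]
        exact Finset.le_sup' V (by simp)
  refine ⟨LinearMap.mkContinuous V C fun x => ?_, hVS, hreg⟩
  have h := hreg.modulus_norm_le x
  simp only [HasModulus.modulus] at h
  rwa [norm_abs_eq_norm, norm_abs_eq_norm] at h

namespace Complexification

theorem real_smul_re (c : ℝ) (z : Complexification Λ) : (c • z).re = c • z.re := by
  rw [← Complex.coe_smul, smul_re]; simp

theorem isLatticeSeminorm_modulus :
    IsLatticeSeminorm (modulus : Complexification Λ → Λ) :=
  ⟨modulus_nonneg, modulus_add_le, fun c z => by
    rw [← Complex.coe_smul, modulus_smul, Complex.norm_real, Real.norm_eq_abs]⟩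

theorem modulus_smul_le_of_norm_le_one {c : ℂ} (hc : ‖c‖ ≤ 1) (z : Complexification Λ) :
    modulus (c • z) ≤ modulus z := by
  rw [modulus_smul]
  calc ‖c‖ • modulus z ≤ (1 : ℝ) • modulus z := smul_le_smul_of_nonneg_right hc (modulus_nonneg z)
    _ = modulus z := one_smul _ _

/-- The modulus is almost dominated by finitely many of the elements `Re (c z)`, `|c| ≤ 1`. -/
theorem exists_finset_modulus_le (z : Complexification L) {ε : ℝ} (hε : 0 < ε) :
    ∃ (t : Finset ℂ) (ht : t.Nonempty), (∀ c ∈ t, ‖c‖ ≤ 1) ∧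
      modulus z ≤ t.sup' ht (fun c => (c • z).re) + ε • (|z.re| + |z.im|) := by
  classical
  have hb : Bornology.IsBounded (conjBall 2 2) := by
    refine (Metric.isBounded_closedBall (x := (0 : Fin 2 → ℝ)) (r := 1)).subset fun a ha => ?_
    rw [mem_closedBall_zero_iff, pi_norm_le_iff_of_nonneg zero_le_one]
    exact fun i => abs_le_of_mem_conjBall ha i
  obtain ⟨t, ht, hnet⟩ := exists_finset_linearComb_le hb ![z.re, z.im] hε
  obtain ⟨b, hb, -⟩ := hnet 0 zero_mem_conjBall
  refine ⟨t.image fun a => ⟨a 0, -a 1⟩, ⟨_, Finset.mem_image_of_mem _ hb⟩, ?_, ?_⟩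
  · intro c hc
    obtain ⟨a, ha, rfl⟩ := Finset.mem_image.1 hc
    have h := mem_conjBall_two.1 (ht a ha)
    rw [← sq_le_one_iff₀ (norm_nonneg _), Complex.sq_norm, Complex.normSq_apply]
    simp only [neg_mul_neg]
    linarith
  · refine (isLUB_lpSum 2 ![z.re, z.im]).2 ?_
    rintro _ ⟨a, ha, rfl⟩
    obtain ⟨b, hb, hle⟩ := hnet a ha
    refine hle.trans (add_le_add ?_ (le_of_eq ?_))
    · refine le_trans (le_of_eq ?_) (Finset.le_sup' (fun c : ℂ => (c • z).re)
        (Finset.mem_image_of_mem (fun a : Fin 2 → ℝ => (⟨a 0, -a 1⟩ : ℂ)) hb))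
      simp [Fin.sum_univ_two]
    · simp [Fin.sum_univ_two]

/-- The complex linear map with real part `V`. -/
noncomputable def ofRealPart {F : Type w} [AddCommGroup F] [Module ℝ F]
    (V : Complexification Λ →ₗ[ℝ] F) : Complexification Λ →ₗ[ℂ] Complexification F where
  toFun z := ⟨V z, -V (Complex.I • z)⟩
  map_add' z w := by
    ext
    · simp
    · simp [add_comm]
  map_smul' c z := by
    have h1 : c • z = c.re • z + c.im • (Complex.I • z) := by
      rw [← Complex.coe_smul, ← Complex.coe_smul, smul_smul, ← add_smul, Complex.re_add_im]
    have h2 : Complex.I • c • z = c.re • (Complex.I • z) - c.im • z := by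
      rw [h1, smul_add, smul_comm, sub_eq_add_neg, smul_comm Complex.I c.im, smul_smul Complex.I,
        Complex.I_mul_I, neg_one_smul, smul_neg]
    ext
    · simp only [smul_re, RingHom.id_apply]
      rw [h1, map_add, map_smul, map_smul, smul_neg, sub_neg_eq_add]
    · simp only [smul_im, RingHom.id_apply]
      rw [h2, map_sub, V.map_smul, V.map_smul]
      simp [sub_eq_add_neg, add_comm]

theorem re_smul_ofRealPart {F : Type w} [AddCommGroup F] [Module ℝ F]
    (V : Complexification Λ →ₗ[ℝ] F) (c : ℂ) (z : Complexification Λ) :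
    (c • ofRealPart V z).re = V (c • z) := by
  rw [← map_smul]; rfl

theorem exists_regular_bidual_extension {p : ℝ≥0∞} (hp : 1 ≤ p) (hΛ : IsPConvex p Λ)
    (hL : IsPConcave p L) (S : Submodule ℂ (Complexification Λ)) (T : S →L[ℂ] Complexification L)
    {C : ℝ} (hT : HasRegularBound T C) :
    ∃ V : Complexification Λ →L[ℂ] Complexification (DualLattice (DualLattice L)),
      (∀ s : S, V s = (T s).toBidual) ∧ HasRegularBound V C := by
  classical
  have hdom := hT.preservesDomination (X := S) (fun s => modulus_nonneg (s : Complexification Λ))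
    (R := fun y : Complexification L => y.re) fun y => abs_re_le_modulus y
  -- Only the real part of `T` is extended, as a real linear map; complex linearity returns through
  -- `ofRealPart`.
  let T₀ : S.restrictScalars ℝ →ₗ[ℝ] L :=
    { toFun := fun s => (T ⟨s.1, s.2⟩).re
      map_add' := fun s s' => by
        rw [← add_re, ← map_add]; rfl
      map_smul' := fun c s => by
        rw [RingHom.id_apply, ← real_smul_re, ← Complex.coe_smul, ← map_smul]; rfl }
  obtain ⟨V, hVS, hV⟩ := BanachLat.exists_bidual_extension hp hΛ hL isLatticeSeminorm_modulus
    (S.restrictScalars ℝ) T₀ hT.1 hdom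
  have hreg : HasRegularBound (ofRealPart V) C := by
    refine ⟨hT.1, fun n x => ?_⟩
    have hx : ∀ i, modulus (x i) ≤
        Finset.univ.sup' Finset.univ_nonempty fun i => modulus (x i) := fun i =>
      Finset.le_sup' (fun i => modulus (x i)) (Finset.mem_univ i)
    -- One error term for all `i`: the modulus is an infinite supremum over `|c| ≤ 1`, which a
    -- finite net reaches only up to `ε` times this element.
    set R : DualLattice (DualLattice L) :=
      ∑ i, (|(ofRealPart V (x i)).re| + |(ofRealPart V (x i)).im|) with hR
    refine norm_le_of_forall_le_sup' (R := R) hT.1 hV ?_ ((modulus_nonneg _).trans (hx 0))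
      fun ε hε => ?_
    · exact (modulus_nonneg (ofRealPart V (x 0))).trans
        (Finset.le_sup' (fun i => modulus (ofRealPart V (x i))) (Finset.mem_univ 0))
    choose t htne ht1 ht using fun i => exists_finset_modulus_le (ofRealPart V (x i)) hε
    have hmem : ∀ i, ∀ c ∈ t i,
        c • x i ∈ Finset.univ.biUnion fun i => (t i).image fun c => c • x i := fun i c hc =>
      Finset.mem_biUnion.2 ⟨i, Finset.mem_univ i, Finset.mem_image_of_mem _ hc⟩
    obtain ⟨c₀, hc₀⟩ := htne 0
    refine ⟨Finset.univ.biUnion fun i => (t i).image fun c => c • x i, ⟨_, hmem 0 c₀ hc₀⟩, ?_, ?_⟩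
    · intro z hz
      simp only [Finset.mem_biUnion, Finset.mem_image, Finset.mem_univ, true_and] at hz
      obtain ⟨i, c, hc, rfl⟩ := hz
      exact (modulus_smul_le_of_norm_le_one (ht1 i c hc) _).trans (hx i)
    · refine Finset.sup'_le _ _ fun i _ => (ht i).trans (add_le_add ?_ ?_)
      · refine Finset.sup'_le _ _ fun c hc => ?_
        -- `Re (c · ofRealPart V (x i))` is the value of `V` at `c • x i`, whose modulus is no
        -- larger than that of `x i`.
        rw [re_smul_ofRealPart]
        exact Finset.le_sup' V (hmem i c hc)
      · refine smul_le_smul_of_nonneg_left ?_ hε.le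
        exact Finset.single_le_sum
          (f := fun i => |(ofRealPart V (x i)).re| + |(ofRealPart V (x i)).im|)
          (fun i _ => add_nonneg (abs_nonneg _) (abs_nonneg _)) (Finset.mem_univ i)
  refine ⟨LinearMap.mkContinuous (ofRealPart V) C fun x => hreg.modulus_norm_le x, fun s => ?_,
    hreg⟩
  change ofRealPart V s = _
  have h1 : ∀ s : S, V s = DualLattice.toBidual (T s).re := fun s => hVS ⟨s.1, s.2⟩
  ext1
  · exact h1 s
  · change -V (Complex.I • (s : Complexification Λ)) = DualLattice.toBidual (T s).im
    rw [← Submodule.coe_smul, h1, map_smul, ← map_neg]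
    simp

end Complexification

end Extension
end BanachLat

open BanachLat
theorem theorem4 {Λ : Type u} {L : Type v}
    [NormedAddCommGroup Λ] [NormedSpace ℝ Λ] [Lattice Λ] [IsOrderedAddMonoid Λ]
    [HasSolidNorm Λ] [IsOrderedModule ℝ Λ] [CompleteSpace Λ]
    [NormedAddCommGroup L] [NormedSpace ℝ L] [Lattice L] [IsOrderedAddMonoid L]
    [HasSolidNorm L] [IsOrderedModule ℝ L] [CompleteSpace L]
    (p : ℝ≥0∞) (hp : 1 ≤ p) :
    -- real Banach lattices `Λ` and `L`
    (((IsDualLattice.{v, w} L ∨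
        ∃ P : DualLattice (DualLattice L) →L[ℝ] L,
          (∀ y : L, P (DualLattice.toBidual y) = y) ∧ IsRegularOp P ∧ regularNorm P ≤ 1) →
      IsPConvex p Λ → IsPConcave p L →
      ∀ S : Submodule ℝ Λ, IsClosed (S : Set Λ) →
      ∀ T : S →L[ℝ] L, IsRegularOp T →
        ∃ T' : Λ →L[ℝ] L, (∀ s : S, T' s = T s) ∧ IsRegularOp T' ∧
          regularNorm T' = regularNorm T)) ∧
    -- complex Banach lattices `Λ + iΛ` and `L + iL`
    ((IsDualLattice.{v, w} L ∨
        ∃ P : Complexification (DualLattice (DualLattice L)) →L[ℂ] Complexification L,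
          (∀ y : Complexification L, P y.toBidual = y) ∧ IsRegularOp P ∧ regularNorm P ≤ 1) →
      IsPConvex p (Complexification Λ) → IsPConcave p (Complexification L) →
      ∀ S : Submodule ℂ (Complexification Λ), IsClosed (S : Set (Complexification Λ)) →
      ∀ T : S →L[ℂ] Complexification L, IsRegularOp T →
        ∃ T' : Complexification Λ →L[ℂ] Complexification L,
          (∀ s : S, T' s = T s) ∧ IsRegularOp T' ∧ regularNorm T' = regularNorm T) := by
  constructor
  · intro hproj hΛ hL S _ T hT
    -- Both alternatives supply a projection with regular bound `1`, so composing with it leaves the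
    -- bound of the bidual extension unchanged.
    obtain ⟨P, hP, hPb⟩ : ∃ P : DualLattice (DualLattice L) →L[ℝ] L,
        (∀ y : L, P (DualLattice.toBidual y) = y) ∧ HasRegularBound P 1 := by
      rcases hproj with hdual | ⟨P, hP, hPr, hP1⟩
      · obtain ⟨P, hP, hP0, hPn⟩ := hdual.exists_projection
        exact ⟨P, hP, hasRegularBound_one_of_nonneg hP0 hPn⟩
      · exact ⟨P, hP, hPr.hasRegularBound.mono hP1⟩
    obtain ⟨V, hVS, hV⟩ := exists_regular_bidual_extension hp hΛ hL S T hT.hasRegularBound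
    have hb : HasRegularBound (P ∘L V) (regularNorm T) := by
      have h := hPb.comp hV
      rwa [one_mul] at h
    have hext : ∀ s : S, (P ∘L V) s = T s := fun s => by
      rw [ContinuousLinearMap.comp_apply, hVS, hP]
    exact ⟨P ∘L V, hext, ⟨_, hb⟩, regularNorm_eq_of_extends hext hb⟩
  · intro hproj hΛ hL S _ T hT
    obtain ⟨P, hP, hPb⟩ : ∃ P : Complexification (DualLattice (DualLattice L)) →L[ℂ]
        Complexification L, (∀ y : Complexification L, P y.toBidual = y) ∧
          HasRegularBound P 1 := by
      rcases hproj with hdual | ⟨P, hP, hPr, hP1⟩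
      · obtain ⟨P, hP, hP0, hPn⟩ := hdual.exists_projection
        -- The positive projection of the real dual lattice acts on real and imaginary parts
        -- separately.
        obtain ⟨Q, hQ, hQb⟩ := Complexification.exists_map hP0 hPn
        refine ⟨Q, fun y => ?_, hQb⟩
        rw [hQ]
        exact Complexification.ext (hP y.re) (hP y.im)
      · exact ⟨P, hP, hPr.hasRegularBound.mono hP1⟩
    obtain ⟨V, hVS, hV⟩ := Complexification.exists_regular_bidual_extension hp
      hΛ.of_complexification hL.of_complexification S T hT.hasRegularBound
    have hb : HasRegularBound (P ∘L V) (regularNorm T) := by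
      have h := hPb.comp hV
      rwa [one_mul] at h
    have hext : ∀ s : S, (P ∘L V) s = T s := fun s => by
      rw [ContinuousLinearMap.comp_apply, hVS, hP]
    exact ⟨P ∘L V, hext, ⟨_, hb⟩, regularNorm_eq_of_extends hext hb⟩
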